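/- Let $m\in\mathbb{Q}[x,y,z]$ be irreducible over $\mathbb{Q}$ and let $\mathcal{M}\subseteq\mathbb{R}^3$ be a nonempty relatively open subset of the set of nonsingular real zeros of $m$, i.e. of the points with $m=0$ and $\nabla m\neq 0$ (an irreducible surface). For a finite simple graph $G=(V,E)$ and $p:V\to\mathcal{M}$, an infinitesimal flex of $(G,p)$ on $\mathcal{M}$ is an assignment of velocities $u_v\in\mathbb{R}^3$ ($v\in V$) with $u_v\cdot\nabla m(p_v)=0$ for all $v\in V$ and $u_v\cdot(p_v-p_w)=u_w\cdot(p_v-p_w)$ for all $vw\in E$. The rigidity matrix $R_{\mathcal{M}}(G,p)$ is the $(|E|+|V|)\times 3|V|$ matrix of these linear conditions on $u$. The surface $\mathcal{M}$ is of type $k$ if $k$ is the largest integer with $\dim\ker R_{\mathcal{M}}(K_n,p)\ge k$ for all $n\ge 2$ and all $p\in\mathcal{M}^n$. The framework $(G,p)$ is infinitesimally rigid on $\mathcal{M}$ if every infinitesimal flex $u$ has the form $u_v=a\times p_v+b$ with $a,b\in\mathbb{R}^3$ such that $(a\times x+b)\cdot\nabla m(x)=0$ for every $x\in\mathcal{M}$;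 it is independent if the rows of $R_{\mathcal{M}}(G,p)$ are linearly independent. It is generic if every polynomial over $\mathbb{Q}$ in the coordinates of the points that vanishes at $p$ lies in the ideal generated by the polynomials $m(X_v,Y_v,Z_v)$, $v\in V$. A vertex-to-$K_4$ move $G\to G'$ replaces a vertex $v$ of $G$ by a copy of $K_4$ on four new vertices and replaces each edge $xv$ of $G$ by one edge $xw$, where $w$ is an arbitrarily chosen vertex of this $K_4$ (depending on $x$). **Corollary.** Let $\mathcal{M}$ be an irreducible surface of type $1$ or $0$ and let $G\to G'$ be a vertex-to-$K_4$ move between finite simple graphs. If every generic framework $(G,p)$ on $\mathcal{M}$ is infinitesimally rigid on $\mathcal{M}$, then every generic framework $(G',p')$ on $\mathcal{M}$ is infinitesimally rigid on $\mathcal{M}$. Likewise, if every generic framework $(G,p)$ on $\mathcal{M}$ is independent, then every generic framework $(G',p')$ on $\mathcal{M}$ is independent. In particular, the move preserves generic minimal infinitesimal rigidity (infinitesimal rigidity together with independence). -/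

import Mathlib

open scoped Matrix

namespace SurfaceFramework

noncomputable section

/-- The gradient `∇m` at `x`, for a polynomial `m` over `ℚ` in three variables. It is the normal
vector used at the points of the surface `m = 0`. -/
def normal (m : MvPolynomial (Fin 3) ℚ) (x : Fin 3 → ℝ) : Fin 3 → ℝ :=
  fun i => MvPolynomial.aeval x (MvPolynomial.pderiv i m)

/-- The nonsingular real zeros of `m`. -/
def regularZeros (m : MvPolynomial (Fin 3) ℚ) : Set (Fin 3 → ℝ) :=
  {x | MvPolynomial.aeval x m = 0 ∧ normal m x ≠ 0}

/-- `M` is an irreducible surface with polynomial `m`: the polynomial `m` is irreducible over `ℚ`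
and `M` is a two-dimensional embedded manifold consisting of nonsingular real zeros of `m`.
The nonsingular zeros form an embedded analytic surface, so its two-dimensional embedded
submanifolds are exactly its relatively open subsets. -/
structure IsIrreducibleSurface (m : MvPolynomial (Fin 3) ℚ) (M : Set (Fin 3 → ℝ)) : Prop where
  irreducible : Irreducible m
  nonempty : M.Nonempty
  isSurface : ∃ U : Set (Fin 3 → ℝ), IsOpen U ∧ M = U ∩ regularZeros m

/-- The entry of the row of an edge `e` in the column of the `i`-th coordinate of the vertex `w`:
for `e = ab` it is `(p a - p b) i` if `w = a`, `(p b - p a) i` if `w = b`, and `0` otherwise. -/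
def edgeEntry {V : Type*} (p : V → Fin 3 → ℝ) (w : V) (i : Fin 3) : Sym2 V → ℝ :=
  open Classical in
  Sym2.lift ⟨fun a b => if w = a then p a i - p b i else if w = b then p b i - p a i else 0, by
    intro a b
    dsimp only
    split_ifs with ha hb hb
    · rw [← ha, ← hb]
    · rfl
    · rfl
    · rfl⟩

/-- The rigidity matrix of the framework `(G, p)` on the surface with polynomial `m`: one row for
every edge, then one row for every vertex, and three columns for every vertex. -/
def rigidityMatrix {V : Type*} (m : MvPolynomial (Fin 3) ℚ) (G : SimpleGraph V)
    (p : V → Fin 3 → ℝ) : Matrix (G.edgeSet ⊕ V) (V × Fin 3) ℝ :=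
  open Classical in
  fun r c => match r with
    | Sum.inl e => edgeEntry p c.1 c.2 (e : Sym2 V)
    | Sum.inr v => if c.1 = v then normal m (p v) c.2 else 0

/-- The surface `M` is of type `k` (has freedom number `k`): `dim ker R_M(K_n, p) ≥ k` for all
frameworks `(K_n, p)` on `M` with `n ≥ 2`, and `k` is the largest such number. -/
def HasType (m : MvPolynomial (Fin 3) ℚ) (M : Set (Fin 3 → ℝ)) (k : ℕ) : Prop :=
  IsGreatest {k : ℕ | ∀ n : ℕ, 2 ≤ n → ∀ p : Fin n → Fin 3 → ℝ, (∀ i, p i ∈ M) →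
    k ≤ Module.finrank ℝ (LinearMap.ker (rigidityMatrix m (⊤ : SimpleGraph (Fin n)) p).mulVecLin)} k

/-- `u` is an infinitesimal flex of `(G, p)` on the surface: the velocities are tangential and
satisfy the first-order length condition along every edge. -/
def IsInfinitesimalFlex {V : Type*} (m : MvPolynomial (Fin 3) ℚ) (G : SimpleGraph V)
    (p u : V → Fin 3 → ℝ) : Prop :=
  (∀ v, u v ⬝ᵥ normal m (p v) = 0) ∧
    ∀ v w, G.Adj v w → u v ⬝ᵥ (p v - p w) = u w ⬝ᵥ (p v - p w)

/-- `(a, b)` encodes an infinitesimal isometry `x ↦ a × x + b` of `ℝ³` that acts tangentially at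
every point of the surface `M`. -/
def IsRigidMotion (m : MvPolynomial (Fin 3) ℚ) (M : Set (Fin 3 → ℝ)) (a b : Fin 3 → ℝ) : Prop :=
  ∀ x ∈ M, (a ⨯₃ x + b) ⬝ᵥ normal m x = 0

/-- `(G, p)` is infinitesimally rigid on `M`: every infinitesimal flex is the restriction of an
infinitesimal isometry of `ℝ³` that acts tangentially at every point of `M`. -/
def IsInfinitesimallyRigid {V : Type*} (m : MvPolynomial (Fin 3) ℚ) (M : Set (Fin 3 → ℝ))
    (G : SimpleGraph V) (p : V → Fin 3 → ℝ) : Prop :=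
  ∀ u : V → Fin 3 → ℝ, IsInfinitesimalFlex m G p u →
    ∃ a b : Fin 3 → ℝ, IsRigidMotion m M a b ∧ ∀ v, u v = a ⨯₃ p v + b

/-- `(G, p)` is independent: its rigidity matrix has linearly independent rows. -/
def IsIndependent {V : Type*} (m : MvPolynomial (Fin 3) ℚ) (G : SimpleGraph V)
    (p : V → Fin 3 → ℝ) : Prop :=
  LinearIndependent ℝ (rigidityMatrix m G p).row

/-- The placement `p` of the vertices is generic on `M`: all points lie on `M`, and a polynomial
over `ℚ` vanishes at the coordinates of all the points only if it lies in the ideal generated by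
the polynomials `m(X_v, Y_v, Z_v)`. -/
def IsGeneric {V : Type*} (m : MvPolynomial (Fin 3) ℚ) (M : Set (Fin 3 → ℝ))
    (p : V → Fin 3 → ℝ) : Prop :=
  (∀ v, p v ∈ M) ∧
    ∀ h : MvPolynomial (V × Fin 3) ℚ,
      MvPolynomial.aeval (fun c : V × Fin 3 => p c.1 c.2) h = 0 →
        h ∈ Ideal.span (Set.range fun v : V =>
          MvPolynomial.rename (fun i : Fin 3 => ((v, i) : V × Fin 3)) m)

/-- Every generic framework `(G, p)` on `M` is infinitesimally rigid on `M`. -/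
def GenericallyRigid {V : Type*} (m : MvPolynomial (Fin 3) ℚ) (M : Set (Fin 3 → ℝ))
    (G : SimpleGraph V) : Prop :=
  ∀ p : V → Fin 3 → ℝ, IsGeneric m M p → IsInfinitesimallyRigid m M G p

/-- Every generic framework `(G, p)` on `M` is independent. -/
def GenericallyIndependent {V : Type*} (m : MvPolynomial (Fin 3) ℚ) (M : Set (Fin 3 → ℝ))
    (G : SimpleGraph V) : Prop :=
  ∀ p : V → Fin 3 → ℝ, IsGeneric m M p → IsIndependent m G p

/-- The adjacency relation after replacing the vertex `v` by a copy of `K₄` on `Fin 4`, where every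
edge `xv` is replaced by the edge from `x` to the vertex `f x` of `K₄`. -/
def vertexToK4Adj {V : Type*} (G : SimpleGraph V) (v : V) (f : V → Fin 4) :
    {x : V // x ≠ v} ⊕ Fin 4 → {x : V // x ≠ v} ⊕ Fin 4 → Prop
  | Sum.inl x, Sum.inl y => G.Adj x y
  | Sum.inl x, Sum.inr i => G.Adj x v ∧ f x = i
  | Sum.inr i, Sum.inl x => G.Adj x v ∧ f x = i
  | Sum.inr i, Sum.inr j => i ≠ j

/-- The graph obtained from `G` by the vertex-to-`K₄` move at `v` with edge assignment `f`. -/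
def vertexToK4 {V : Type*} (G : SimpleGraph V) (v : V) (f : V → Fin 4) :
    SimpleGraph ({x : V // x ≠ v} ⊕ Fin 4) where
  Adj := vertexToK4Adj G v f
  symm := ⟨by
    rintro (x | i) (y | j) h
    · exact SimpleGraph.Adj.symm h
    · exact h
    · exact h
    · exact Ne.symm h⟩
  loopless := ⟨by
    rintro (x | i) h
    · exact G.loopless.irrefl _ h
    · exact h rfl⟩

/-- `G'` arises from `G` by a vertex-to-`K₄` move, up to the naming of the vertices. -/
def IsVertexToK4Move {V V' : Type*} (G : SimpleGraph V) (G' : SimpleGraph V') : Prop :=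
  ∃ (v : V) (f : V → Fin 4), Nonempty (G' ≃g vertexToK4 G v f)

end

end SurfaceFramework

namespace SurfaceFramework

open MvPolynomial Module

/-! ### Generic placements and their specializations -/

section Generic

variable {V W : Type*} {m : MvPolynomial (Fin 3) ℚ} {M : Set (Fin 3 → ℝ)}

/-! A generic placement `p'` of `G'` restricts to a generic placement `p` of `G`, one vertex of the
`K₄` taking the role of `v`. Everything rests on the inequality dim flex(G', p') ≤ dim flex(G, p).
It gives rigidity because the trivial motions of `p` are restrictions of those of `p'`, which
squeezes all dimensions together. It gives independence because the move adds nine columns and at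
most nine rows, so the rank must grow by the full number of new rows. Generic placements minimize
the flex dimension (`IsGeneric.finrank_flexSpace_le`), so one special placement of `G'` satisfying
the bound suffices (`exists_placement_vertexToK4`).

In the special placement the `K₄` is shrunk towards `p v`. After rescaling by the size `t`, its
limit is a `K₄` in the tangent plane, whose tangential flexes are translations and one rotation. The
rotation is excluded by a second-order condition. The affine dependency `c` of the four limit points
gives a rank-one stress, and the curvature of the surface makes the combination Σ cᵢ pᵢ a nonzero
multiple of the normal `n`. Hence Σ cᵢ uᵢ is orthogonal to `n`. Subtracting the tangency conditions
and dividing by `t` leaves, in the limit, Σ cᵢ uᵢ · H qᵢ = 0 with `H` the Hessian of `m`. If `p v`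
is not umbilic, the shape of the `K₄` can be chosen so that this kills the rotation. The four
velocities then agree and define a flex of (G, p), and upper semicontinuity of kernel dimensions
carries the bound to small `t`.

The type enters only through `exists_not_umbilic`. If a generic point were umbilic, the umbilic
equations would hold in the function field of the surface, and the classical proof that a totally
umbilic surface is a plane or a sphere can be run there with derivations. The normal direction or
the centre of curvature is killed by two independent derivations, hence algebraic over ℚ, hence
constant on `M` by comparing two generic points. Then `M` lies in parallel planes or concentric
spheres and has type at least 2. -/

theorem IsIrreducibleSurface.subset (hM : IsIrreducibleSurface m M) : M ⊆ regularZeros m := by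
  obtain ⟨U, -, rfl⟩ := hM.isSurface
  exact Set.inter_subset_right

/-- A polynomial vanishing at a generic placement vanishes at every family of zeros of `m`. -/
theorem IsGeneric.aeval_eq_zero {p : V → Fin 3 → ℝ} (hp : IsGeneric m M p)
    {h : MvPolynomial (V × Fin 3) ℚ} (h0 : aeval (fun c : V × Fin 3 => p c.1 c.2) h = 0)
    {A : Type*} [CommRing A] [Algebra ℚ A] (q : V → Fin 3 → A) (hq : ∀ v, aeval (q v) m = 0) :
    aeval (fun c : V × Fin 3 => q c.1 c.2) h = 0 := by
  have hle : Ideal.span (Set.range fun v : V =>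
      rename (fun i : Fin 3 => ((v, i) : V × Fin 3)) m) ≤
      RingHom.ker (aeval (fun c : V × Fin 3 => q c.1 c.2)) := by
    rw [Ideal.span_le]
    rintro _ ⟨v, rfl⟩
    rw [SetLike.mem_coe, RingHom.mem_ker, aeval_rename]
    exact hq v
  exact (RingHom.mem_ker).1 (hle (hp.2 h h0))

/-- A relation among the selected points is pushed forward along `g`, placed in the ideal there, and
pulled back along `r`. Renaming along `r` undoes `g` and sends each generator to a generator. -/
theorem IsGeneric.comp {p : V → Fin 3 → ℝ} (hp : IsGeneric m M p) {g : W → V} {r : V → W}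
    (hr : Function.LeftInverse r g) : IsGeneric m M (p ∘ g) := by
  refine ⟨fun w => hp.1 (g w), fun h h0 => ?_⟩
  have h1 : rename (Prod.map g id) h ∈ _ := hp.2 (rename (Prod.map g id) h) (by
    rw [aeval_rename]; exact h0)
  have h2 := Ideal.mem_map_of_mem (rename (Prod.map r (id : Fin 3 → Fin 3)) :
    MvPolynomial (V × Fin 3) ℚ →ₐ[ℚ] MvPolynomial (W × Fin 3) ℚ) h1
  rw [rename_rename, Prod.map_comp_map, hr.comp_eq_id, Function.id_comp, Prod.map_id,
    rename_id_apply, Ideal.map_span, ← Set.range_comp] at h2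
  refine Ideal.span_mono ?_ h2
  rintro _ ⟨v, rfl⟩
  refine ⟨r v, ?_⟩
  simp only [Function.comp_apply, rename_rename]
  rfl

end Generic

/-! ### Flexes as the kernel of the rigidity matrix -/

section FlexSpace

variable {V : Type*} (m : MvPolynomial (Fin 3) ℚ) (G : SimpleGraph V) (p : V → Fin 3 → ℝ)

/-- The space of infinitesimal flexes. -/
def flexSpace : Submodule ℝ (V → Fin 3 → ℝ) where
  carrier := {u | IsInfinitesimalFlex m G p u}
  add_mem' := by
    rintro a b ⟨ha, ha'⟩ ⟨hb, hb'⟩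
    refine ⟨fun v => ?_, fun v w h => ?_⟩
    · simp [ha v, hb v]
    · rw [Pi.add_apply, Pi.add_apply, add_dotProduct, add_dotProduct, ha' v w h, hb' v w h]
  zero_mem' := by simp [IsInfinitesimalFlex]
  smul_mem' := by
    rintro c a ⟨ha, ha'⟩
    refine ⟨fun v => ?_, fun v w h => ?_⟩
    · simp [ha v]
    · rw [Pi.smul_apply, Pi.smul_apply, smul_dotProduct, smul_dotProduct, ha' v w h]

@[simp] theorem mem_flexSpace {u : V → Fin 3 → ℝ} :
    u ∈ flexSpace m G p ↔ IsInfinitesimalFlex m G p u := Iff.rfl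

variable {m G p}

theorem sum_edgeEntry_mul [Fintype V] (u : V × Fin 3 → ℝ) {a b : V} (hab : a ≠ b) :
    ∑ c : V × Fin 3, edgeEntry p c.1 c.2 s(a, b) * u c =
      (fun i => u (a, i)) ⬝ᵥ (p a - p b) - (fun i => u (b, i)) ⬝ᵥ (p a - p b) := by
  classical
  have key : ∀ w i, edgeEntry p w i s(a, b) * u (w, i) =
      (if w = a then (p a i - p b i) * u (a, i) else 0) +
      (if w = b then (p b i - p a i) * u (b, i) else 0) := by
    intro w i
    simp only [edgeEntry, Sym2.lift_mk]
    by_cases h1 : w = a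
    · subst h1; simp [hab]
    · by_cases h2 : w = b
      · subst h2; simp [h1]
      · simp [h1, h2]
  rw [Fintype.sum_prod_type_right]
  simp only [key, Finset.sum_add_distrib, Finset.sum_ite_eq', Finset.mem_univ, if_true]
  simp only [dotProduct, Fin.sum_univ_three, Pi.sub_apply]
  ring

theorem mem_ker_rigidityMatrix [Fintype V] (u : V × Fin 3 → ℝ) :
    u ∈ LinearMap.ker (rigidityMatrix m G p).mulVecLin ↔
      (fun v i => u (v, i)) ∈ flexSpace m G p := by
  classical
  rw [LinearMap.mem_ker, funext_iff]
  simp only [Matrix.mulVecLin_apply, Matrix.mulVec, dotProduct, Pi.zero_apply]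
  have hv : ∀ v, ∑ c, rigidityMatrix m G p (Sum.inr v) c * u c =
      (fun i => u (v, i)) ⬝ᵥ normal m (p v) := by
    intro v
    rw [Fintype.sum_prod_type_right]
    simp [rigidityMatrix, dotProduct, mul_comm]
  constructor
  · intro h
    refine ⟨fun v => by rw [← hv v]; exact h (Sum.inr v), fun a b hab => ?_⟩
    have h1 := h (Sum.inl ⟨s(a, b), hab⟩)
    have h2 := sum_edgeEntry_mul (p := p) u hab.ne
    rw [show ∑ c : V × Fin 3, edgeEntry p c.1 c.2 s(a, b) * u c = 0 from h1] at h2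
    linarith
  · rintro ⟨h1, h2⟩ (⟨e, he⟩ | v)
    · induction e using Sym2.ind with
      | _ a b =>
        have hab : G.Adj a b := he
        refine (sum_edgeEntry_mul (p := p) u hab.ne).trans ?_
        have := h2 a b hab
        linarith
    · rw [hv v]; exact h1 v

theorem finrank_ker_rigidityMatrix [Fintype V] :
    finrank ℝ (LinearMap.ker (rigidityMatrix m G p).mulVecLin) =
      finrank ℝ (flexSpace m G p) := by
  have : LinearMap.ker (rigidityMatrix m G p).mulVecLin =
      (flexSpace m G p).comap (LinearEquiv.curry ℝ ℝ V (Fin 3)).toLinearMap := by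
    ext u
    rw [mem_ker_rigidityMatrix]
    rfl
  rw [this]
  exact LinearEquiv.finrank_eq
    ((LinearEquiv.curry ℝ ℝ V (Fin 3)).submoduleMap _ |>.trans
      (LinearEquiv.ofEq _ _ (by
        rw [Submodule.map_comap_eq_of_surjective]
        exact (LinearEquiv.curry ℝ ℝ V (Fin 3)).surjective)))

theorem rank_add_finrank_flexSpace [Fintype V] :
    (rigidityMatrix m G p).rank + finrank ℝ (flexSpace m G p) = Fintype.card V * 3 := by
  rw [← finrank_ker_rigidityMatrix, Matrix.rank, LinearMap.finrank_range_add_finrank_ker]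
  simp

theorem isIndependent_iff_rank [Fintype V] :
    IsIndependent m G p ↔
      (rigidityMatrix m G p).rank = Nat.card G.edgeSet + Fintype.card V := by
  classical
  rw [IsIndependent, linearIndependent_iff_card_eq_finrank_span, Set.finrank,
    ← Matrix.rank_eq_finrank_span_row, Fintype.card_sum, eq_comm, Nat.card_eq_fintype_card]

theorem rank_le_card [Fintype V] :
    (rigidityMatrix m G p).rank ≤ Nat.card G.edgeSet + Fintype.card V := by
  classical
  refine (Matrix.rank_le_card_height _).trans ?_
  rw [Fintype.card_sum, Nat.card_eq_fintype_card]

end FlexSpace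

/-! ### Generic maximality of the rank -/

section PolynomialMatrix

open Classical in
/-- The rigidity matrix with polynomial entries in the coordinates of the vertices. -/
noncomputable def polyRigidityMatrix {V : Type*} (m : MvPolynomial (Fin 3) ℚ) (G : SimpleGraph V) :
    Matrix (G.edgeSet ⊕ V) (V × Fin 3) (MvPolynomial (V × Fin 3) ℚ) :=
  fun r c => match r with
    | Sum.inl e =>
      if c.1 = (e : Sym2 V).out.1 then X ((e : Sym2 V).out.1, c.2) - X ((e : Sym2 V).out.2, c.2)
      else if c.1 = (e : Sym2 V).out.2 then
        X ((e : Sym2 V).out.2, c.2) - X ((e : Sym2 V).out.1, c.2)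
      else 0
    | Sum.inr v => if c.1 = v then rename (fun i => (v, i)) (pderiv c.2 m) else 0

variable {V : Type*} {m : MvPolynomial (Fin 3) ℚ} {M : Set (Fin 3 → ℝ)} {G : SimpleGraph V}

theorem map_polyRigidityMatrix (p : V → Fin 3 → ℝ) :
    (polyRigidityMatrix m G).map (aeval fun c : V × Fin 3 => p c.1 c.2) =
      rigidityMatrix m G p := by
  classical
  ext (e | v) ⟨w, i⟩
  · have he : (e : Sym2 V) = s((e : Sym2 V).out.1, (e : Sym2 V).out.2) := by
      rw [Sym2.mk, Prod.mk.eta, Quot.out_eq]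
    simp only [Matrix.map_apply, polyRigidityMatrix, rigidityMatrix]
    conv_rhs => rw [he]
    simp only [edgeEntry, Sym2.lift_mk]
    split_ifs <;> simp
  · simp only [Matrix.map_apply, polyRigidityMatrix, rigidityMatrix]
    split_ifs with h
    · rw [aeval_rename]; rfl
    · simp

/-- Generic placements minimize the dimension of the flex space. -/
theorem IsGeneric.finrank_flexSpace_le [Fintype V] {p q : V → Fin 3 → ℝ} (hp : IsGeneric m M p)
    (hq : ∀ v, aeval (q v) m = 0) :
    finrank ℝ (flexSpace m G p) ≤ finrank ℝ (flexSpace m G q) := by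
  classical
  suffices h : (rigidityMatrix m G q).rank ≤ (rigidityMatrix m G p).rank by
    have h1 := rank_add_finrank_flexSpace (m := m) (G := G) (p := p)
    have h2 := rank_add_finrank_flexSpace (m := m) (G := G) (p := q)
    omega
  obtain ⟨κ, a, ha, hspan, hli⟩ := exists_linearIndependent' ℝ (rigidityMatrix m G q).row
  have : Finite κ := Finite.of_injective a ha
  have := Fintype.ofFinite κ
  -- The rows `a` form a basis of the row space at `q`. Their Gram determinant is a single
  -- polynomial over ℚ that detects independence at every real placement, so no nonvanishing minor
  -- has to be selected.
  set B : Matrix κ (V × Fin 3) (MvPolynomial (V × Fin 3) ℚ) :=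
    (polyRigidityMatrix m G).submatrix a id with hB
  have hBmap : ∀ r : V → Fin 3 → ℝ, aeval (fun c : V × Fin 3 => r c.1 c.2) (B * Bᵀ).det =
      ((rigidityMatrix m G r).submatrix a id * ((rigidityMatrix m G r).submatrix a id)ᵀ).det := by
    intro r
    rw [AlgHom.map_det]
    congr 1
    rw [AlgHom.mapMatrix_apply, Matrix.map_mul, Matrix.transpose_map, hB, ← Matrix.submatrix_map,
      map_polyRigidityMatrix]
  have hrank : ((rigidityMatrix m G q).submatrix a id).rank = Fintype.card κ :=
    LinearIndependent.rank_matrix hli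
  have hrankq : (rigidityMatrix m G q).rank = Fintype.card κ := by
    rw [← hrank, Matrix.rank_eq_finrank_span_row, Matrix.rank_eq_finrank_span_row, ← hspan]
    rfl
  have hdq : aeval (fun c : V × Fin 3 => q c.1 c.2) (B * Bᵀ).det ≠ 0 := by
    rw [hBmap]
    intro h0
    have h1 : LinearIndependent ℝ ((rigidityMatrix m G q).submatrix a id *
        ((rigidityMatrix m G q).submatrix a id)ᵀ).row := by
      rw [linearIndependent_iff_card_eq_finrank_span, Set.finrank,
        ← Matrix.rank_eq_finrank_span_row, Matrix.rank_self_mul_transpose, hrank]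
    rw [Matrix.linearIndependent_rows_iff_isUnit, Matrix.isUnit_iff_isUnit_det, h0] at h1
    exact not_isUnit_zero h1
  have hdp : aeval (fun c : V × Fin 3 => p c.1 c.2) (B * Bᵀ).det ≠ 0 :=
    fun h0 => hdq (hp.aeval_eq_zero h0 q hq)
  rw [hBmap] at hdp
  have h2 := Matrix.rank_of_det_ne_zero hdp
  rw [Matrix.rank_self_mul_transpose] at h2
  rw [hrankq, ← h2]
  exact Matrix.rank_submatrix_le _ _ _

end PolynomialMatrix

end SurfaceFramework

/-! ### Second-order expansion of the surface and semicontinuity of kernels -/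

namespace SurfaceFramework

open MvPolynomial Module Filter Topology

/-- The Hessian matrix of a polynomial. -/
noncomputable def hessian (m : MvPolynomial (Fin 3) ℚ) (x : Fin 3 → ℝ) :
    Matrix (Fin 3) (Fin 3) ℝ :=
  fun a b => aeval x (pderiv a (pderiv b m))

/-- The commutator of two partial derivatives is a derivation that vanishes on the variables. -/
theorem hessian_symm (m : MvPolynomial (Fin 3) ℚ) (x : Fin 3 → ℝ) (a b : Fin 3) :
    hessian m x a b = hessian m x b a := by
  have : pderiv a (pderiv b m) = pderiv b (pderiv a m) := by
    have h : ⁅(pderiv a : Derivation ℚ (MvPolynomial (Fin 3) ℚ) (MvPolynomial (Fin 3) ℚ)),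
        (pderiv b : Derivation ℚ (MvPolynomial (Fin 3) ℚ) (MvPolynomial (Fin 3) ℚ))⁆ = 0 := by
      apply MvPolynomial.derivation_ext
      intro i
      simp [Derivation.commutator_apply, pderiv_X, Pi.single_apply, apply_ite]
    have h2 := congrArg (fun D => D m) h
    simpa [Derivation.commutator_apply, sub_eq_zero] using h2
  rw [hessian, this, hessian]

section Taylor

/-- The second order Taylor expansion of a polynomial, with a continuous remainder. -/
theorem exists_taylor (g : MvPolynomial (Fin 3) ℚ) (x : Fin 3 → ℝ) :
    ∃ R : ℝ × (Fin 3 → ℝ) → ℝ, Continuous R ∧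
      (∀ h, R (0, h) = (h ⬝ᵥ (hessian g x *ᵥ h)) / 2) ∧
      ∀ t h, aeval (x + t • h) g = aeval x g + t * (normal g x ⬝ᵥ h) + t ^ 2 * R (t, h) := by
  induction g using MvPolynomial.induction_on with
  | C a =>
    refine ⟨fun _ => 0, continuous_const, fun h => ?_, fun t h => ?_⟩
    · simp [hessian, Matrix.mulVec, dotProduct]
    · simp [normal, dotProduct]
  | add p q hp hq =>
    obtain ⟨R, hR, hR0, hR1⟩ := hp
    obtain ⟨S, hS, hS0, hS1⟩ := hq
    refine ⟨fun y => R y + S y, hR.add hS, fun h => ?_, fun t h => ?_⟩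
    · simp only [hR0, hS0]
      simp only [hessian, Matrix.mulVec, dotProduct, Fin.sum_univ_three, map_add]
      ring
    · rw [map_add, hR1, hS1]
      simp only [normal, dotProduct, Fin.sum_univ_three, map_add]
      ring
  | mul_X p i hp =>
    obtain ⟨R, hR, hR0, hR1⟩ := hp
    -- These are the terms of order at least two in (p(x) + t ∇p·h + t² R)(xᵢ + t hᵢ), divided by
    -- t².
    refine ⟨fun y => R y * x i + (normal p x ⬝ᵥ y.2) * y.2 i + y.1 * R y * y.2 i, ?_,
      fun h => ?_, fun t h => ?_⟩
    · simp only [dotProduct]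
      fun_prop
    · simp only [hR0]
      simp only [hessian, normal, Matrix.mulVec, dotProduct, Fin.sum_univ_three, Derivation.leibniz,
        smul_eq_mul, map_add, map_mul, pderiv_X, aeval_X]
      fin_cases i <;>
        (simp; ring)
    · rw [map_mul, hR1, aeval_X]
      simp only [normal, dotProduct, Fin.sum_univ_three, Derivation.leibniz,
        smul_eq_mul, map_add, map_mul, pderiv_X, aeval_X, Pi.add_apply, Pi.smul_apply]
      fin_cases i <;>
        (simp; ring)

theorem continuous_aeval (g : MvPolynomial (Fin 3) ℚ) :
    Continuous fun x : Fin 3 → ℝ => aeval x g := by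
  induction g using MvPolynomial.induction_on with
  | C a => simpa using continuous_const
  | add p q hp hq => simp only [map_add]; exact hp.add hq
  | mul_X p i hp => simp only [map_mul, aeval_X]; exact hp.mul (continuous_apply i)

theorem continuous_normal (m : MvPolynomial (Fin 3) ℚ) : Continuous (normal m) :=
  continuous_pi fun _ => continuous_aeval _

/-- `E` is the difference quotient of the gradient, extended continuously to `t = 0`. It allows
combinations of normal conditions at nearby points to be divided by `t` before passing to the limit.
-/
theorem exists_normal_expansion (m : MvPolynomial (Fin 3) ℚ) (x : Fin 3 → ℝ) :
    ∃ E : ℝ × (Fin 3 → ℝ) → (Fin 3 → ℝ), Continuous E ∧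
      (∀ h, E (0, h) = hessian m x *ᵥ h) ∧
      ∀ t h, normal m (x + t • h) = normal m x + t • E (t, h) := by
  choose R hR _ hR1 using fun i => exists_taylor (pderiv i m) x
  refine ⟨fun y i => normal (pderiv i m) x ⬝ᵥ y.2 + y.1 * R i y, ?_, fun h => ?_, fun t h => ?_⟩
  · simp only [dotProduct]
    fun_prop
  · ext i
    simp only [zero_mul, add_zero, Matrix.mulVec, dotProduct]
    refine Finset.sum_congr rfl fun j _ => ?_
    rw [hessian_symm]; rfl
  · ext i
    refine (hR1 i t h).trans ?_
    simp only [normal, Pi.add_apply, Pi.smul_apply, smul_eq_mul]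
    ring

/-- Points of the surface near a point `x`, at prescribed small tangential displacement. -/
theorem eventually_exists_zero (m : MvPolynomial (Fin 3) ℚ) {x : Fin 3 → ℝ}
    (hx : x ∈ regularZeros m) {q : Fin 3 → ℝ} (hq : q ⬝ᵥ normal m x = 0) {δ : ℝ} (hδ : 0 < δ) :
    ∀ᶠ t in 𝓝 (0 : ℝ), t ≠ 0 → ∃ s,
      |s - -(q ⬝ᵥ (hessian m x *ᵥ q)) / (2 * (normal m x ⬝ᵥ normal m x))| ≤ δ ∧
      aeval (x + t • (q + (t * s) • normal m x)) m = 0 := by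
  obtain ⟨R, hR, hR0, hR1⟩ := exists_taylor m x
  set n := normal m x with hn
  set N := n ⬝ᵥ n with hN
  have hNpos : 0 < N := by
    have h1 : 0 ≤ N := by simpa using dotProduct_star_self_nonneg n
    exact lt_of_le_of_ne h1 fun h => hx.2 (dotProduct_self_eq_zero.1 h.symm)
  set s₀ := -(q ⬝ᵥ (hessian m x *ᵥ q)) / (2 * N) with hs₀
  have hs₀N : s₀ * N = -(q ⬝ᵥ (hessian m x *ᵥ q)) / 2 := by
    rw [hs₀]; field_simp
  -- For `t ≠ 0` this is the value of `m` at the displaced point divided by t². At `t = 0` it is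
  -- linear in `s` with root `s₀`, so it changes sign on [s₀ - δ, s₀ + δ] for all small `t`.
  let F : ℝ → ℝ → ℝ := fun t s => s * N + R (t, q + (t * s) • n)
  have hF1 : ∀ s, Continuous fun t => F t s := fun s => by fun_prop
  have hF2 : ∀ t, Continuous (F t) := fun t => by fun_prop
  have hF0 : ∀ s, F 0 s = (s - s₀) * N := fun s => by
    simp only [F, zero_mul, zero_smul, add_zero, hR0]
    linarith
  have hlow : ∀ᶠ t in 𝓝 (0 : ℝ), F t (s₀ - δ) < 0 :=
    (hF1 _).continuousAt.eventually_lt continuousAt_const (by rw [hF0]; nlinarith)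
  have hhigh : ∀ᶠ t in 𝓝 (0 : ℝ), 0 < F t (s₀ + δ) :=
    continuousAt_const.eventually_lt (hF1 _).continuousAt (by rw [hF0]; nlinarith)
  filter_upwards [hlow, hhigh] with t h1 h2 _
  obtain ⟨s, ⟨hs1, hs2⟩, hs⟩ := intermediate_value_Icc (by linarith : s₀ - δ ≤ s₀ + δ)
    (hF2 t).continuousOn ⟨h1.le, h2.le⟩
  refine ⟨s, abs_le.2 ⟨by linarith, by linarith⟩, ?_⟩
  rw [hR1, hx.1, dotProduct_add, dotProduct_comm, hq, dotProduct_smul, smul_eq_mul]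
  have : s * N + R (t, q + (t * s) • n) = 0 := hs
  linear_combination t ^ 2 * this

end Taylor

section Semicontinuity

/-- On a complement `C` of the kernel at `θ₀` the map is injective. Injectivity is an open condition
in finite dimension, so nearby kernels still meet `C` trivially. -/
theorem eventually_finrank_ker_le {Θ E F : Type*} [TopologicalSpace Θ] [NormedAddCommGroup E]
    [NormedSpace ℝ E] [FiniteDimensional ℝ E] [NormedAddCommGroup F] [NormedSpace ℝ F]
    (L : Θ → E →ₗ[ℝ] F) (hL : ∀ u, Continuous fun θ => L θ u) (θ₀ : Θ) :
    ∀ᶠ θ in 𝓝 θ₀, finrank ℝ (LinearMap.ker (L θ)) ≤ finrank ℝ (LinearMap.ker (L θ₀)) := by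
  obtain ⟨C, hC⟩ := Submodule.exists_isCompl (LinearMap.ker (L θ₀))
  let T : Θ → C →L[ℝ] F := fun θ => LinearMap.toContinuousLinearMap ((L θ).domRestrict C)
  have hT : Continuous T := continuous_clm_apply.2 fun u => hL u
  have h0 : Function.Injective (T θ₀) := by
    change Function.Injective ((L θ₀).domRestrict C)
    rw [← LinearMap.ker_eq_bot, LinearMap.ker_domRestrict, ← Submodule.disjoint_iff_comap_eq_bot]
    exact hC.disjoint.symm
  filter_upwards [hT.continuousAt.eventually (ContinuousLinearMap.isOpen_injective.mem_nhds h0)]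
    with θ hθ
  have hinj : LinearMap.ker (L θ) ⊓ C = ⊥ := by
    rw [Submodule.eq_bot_iff]
    rintro y ⟨hy1, hy2⟩
    have h2 : T θ ⟨y, hy2⟩ = T θ 0 := by
      rw [map_zero]; exact hy1
    exact congrArg Subtype.val (hθ h2)
  have h1 := Submodule.finrank_sup_add_finrank_inf_eq (LinearMap.ker (L θ)) C
  have h2 := Submodule.finrank_add_eq_of_isCompl hC
  have h3 := Submodule.finrank_le (LinearMap.ker (L θ) ⊔ C)
  rw [hinj, finrank_bot] at h1
  omega

end Semicontinuity

section Tetrahedron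

/-- The vectors `n`, `e`, `n × e` form an orthogonal basis. The identity used equates the Gram
determinant of `w`, `n`, `e` with the square of their triple product. -/
theorem eq_zero_of_orthogonal {n e w : Fin 3 → ℝ} (hn : n ≠ 0) (he : e ≠ 0) (hen : e ⬝ᵥ n = 0)
    (h1 : w ⬝ᵥ n = 0) (h2 : w ⬝ᵥ e = 0) (h3 : w ⬝ᵥ (n ⨯₃ e) = 0) : w = 0 := by
  have hn' : n ⬝ᵥ n ≠ 0 := fun h => hn (dotProduct_self_eq_zero.1 h)
  have he' : e ⬝ᵥ e ≠ 0 := fun h => he (dotProduct_self_eq_zero.1 h)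
  rw [← dotProduct_self_eq_zero]
  have key : (w ⬝ᵥ w) * ((n ⬝ᵥ n) * (e ⬝ᵥ e)) = 0 := by
    have hid : (w ⬝ᵥ w) * ((n ⬝ᵥ n) * (e ⬝ᵥ e)) = (w ⬝ᵥ w) * (e ⬝ᵥ n) ^ 2 +
        (w ⬝ᵥ (n ⨯₃ e)) ^ 2 + (n ⬝ᵥ n) * (w ⬝ᵥ e) ^ 2
        - 2 * (e ⬝ᵥ n) * (w ⬝ᵥ e) * (w ⬝ᵥ n) + (e ⬝ᵥ e) * (w ⬝ᵥ n) ^ 2 := by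
      simp [dotProduct, Fin.sum_univ_three, cross_apply]
      ring
    rw [hid, hen, h1, h2, h3]
    ring
  rcases mul_eq_zero.1 key with h | h
  · exact h
  · exact absurd h (mul_ne_zero hn' he')

end Tetrahedron

end SurfaceFramework

/-! ### Flexes of a planar tetrahedron -/

namespace SurfaceFramework

open MvPolynomial Module Filter Topology

section Tetrahedron

/-- Displacements of the vertices of a planar `K₄` with affine dependency `tetraCoeff`. -/
def tetraPoint (n e : Fin 3 → ℝ) (α : ℝ) : Fin 4 → Fin 3 → ℝ :=
  ![0, e, n ⨯₃ e, α • e + n ⨯₃ e]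

/-- The coefficients of the affine dependency of the points `tetraPoint`. -/
def tetraCoeff (α : ℝ) : Fin 4 → ℝ := ![-α, α, 1, -1]

theorem sum_tetraCoeff (α : ℝ) : ∑ i, tetraCoeff α i = 0 := by
  simp [tetraCoeff, Fin.sum_univ_four]

theorem sum_tetraCoeff_smul (n e : Fin 3 → ℝ) (α : ℝ) :
    ∑ i, tetraCoeff α i • tetraPoint n e α i = 0 := by
  simp only [tetraCoeff, tetraPoint, Fin.sum_univ_four, Matrix.cons_val]
  module

theorem tetraPoint_dotProduct {n e : Fin 3 → ℝ} (hen : e ⬝ᵥ n = 0) (α : ℝ) (i : Fin 4) :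
    tetraPoint n e α i ⬝ᵥ n = 0 := by
  have h : (n ⨯₃ e) ⬝ᵥ n = 0 := by rw [dotProduct_comm]; exact dot_self_cross n e
  fin_cases i <;> simp [tetraPoint, hen, h]

/-- A planar `K₄` has only planar isometries as tangential flexes. -/
theorem exists_rotation_of_tetra {n e : Fin 3 → ℝ} (hn : n ≠ 0) (he : e ≠ 0) (hen : e ⬝ᵥ n = 0)
    (α : ℝ) {u : Fin 4 → Fin 3 → ℝ} (hu : ∀ i, u i ⬝ᵥ n = 0)
    (hflex : ∀ i j, (u i - u j) ⬝ᵥ (tetraPoint n e α i - tetraPoint n e α j) = 0) :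
    ∃ r : ℝ, ∀ i, u i = u 0 + r • (n ⨯₃ tetraPoint n e α i) := by
  have hc : (n ⨯₃ e) ⬝ᵥ (n ⨯₃ e) = (n ⬝ᵥ n) * (e ⬝ᵥ e) := by
    rw [cross_dot_cross, dotProduct_comm n e, hen]; ring
  have hn' : n ⬝ᵥ n ≠ 0 := fun h => hn (dotProduct_self_eq_zero.1 h)
  have he' : e ⬝ᵥ e ≠ 0 := fun h => he (dotProduct_self_eq_zero.1 h)
  have hne : (n ⬝ᵥ n) * (e ⬝ᵥ e) ≠ 0 := mul_ne_zero hn' he'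
  have hcc : n ⨯₃ (n ⨯₃ e) = -((n ⬝ᵥ n) • e) := by
    have h : n ⨯₃ (n ⨯₃ e) = (e ⬝ᵥ n) • n - (n ⬝ᵥ n) • e := by
      ext i
      fin_cases i <;> simp [cross_apply, dotProduct, Fin.sum_univ_three] <;> ring
    rw [h, hen]; simp
  have hcn : (n ⨯₃ e) ⬝ᵥ n = 0 := by rw [dotProduct_comm]; exact dot_self_cross n e
  have hce : (n ⨯₃ e) ⬝ᵥ e = 0 := by rw [dotProduct_comm]; exact dot_cross_self n e
  have hec : e ⬝ᵥ (n ⨯₃ e) = 0 := dot_cross_self n e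
  have f10 := hflex 1 0
  have f20 := hflex 2 0
  have f12 := hflex 1 2
  have f30 := hflex 3 0
  have f31 := hflex 3 1
  have f32 := hflex 3 2
  simp only [tetraPoint, Matrix.cons_val, sub_zero, sub_dotProduct, dotProduct_sub,
    dotProduct_add, dotProduct_smul, smul_eq_mul] at f10 f20 f12 f30 f31 f32
  -- The angular velocity is read off from vertex 1: a rotation moves `e` along `n × e`, whose
  -- squared length is |n|²|e|².
  refine ⟨((u 1 - u 0) ⬝ᵥ (n ⨯₃ e)) / ((n ⬝ᵥ n) * (e ⬝ᵥ e)), fun i => ?_⟩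
  set r := ((u 1 - u 0) ⬝ᵥ (n ⨯₃ e)) / ((n ⬝ᵥ n) * (e ⬝ᵥ e)) with hr
  have hr' : r * ((n ⬝ᵥ n) * (e ⬝ᵥ e)) = u 1 ⬝ᵥ (n ⨯₃ e) - u 0 ⬝ᵥ (n ⨯₃ e) := by
    rw [hr, div_mul_cancel₀ _ hne, sub_dotProduct]
  clear_value r
  rw [← sub_eq_zero]
  apply eq_zero_of_orthogonal hn he hen
  · rw [sub_dotProduct, add_dotProduct, hu, hu, smul_dotProduct, dotProduct_comm (n ⨯₃ _),
      dot_self_cross]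
    simp
  · fin_cases i <;>
      simp [tetraPoint, hcc, hce, sub_dotProduct, add_dotProduct]
    · linarith
    · linarith
    · linear_combination f30 - f31 - (α - 1) * f10 + hr'
  · fin_cases i <;>
      simp [tetraPoint, hcc, hec, hc, sub_dotProduct, add_dotProduct]
    · linarith
    · linarith
    · linear_combination f30 - f32 + α * f12 - α * f10 - α * f20 - α * hr'

/-- A tangential flex of a planar `K₄` that satisfies the second order condition coming from the
curvature of the surface is a translation. -/
theorem eq_of_tetra_flex {n e : Fin 3 → ℝ} {H : Matrix (Fin 3) (Fin 3) ℝ} (hH : ∀ i j, H i j = H j i)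
    (hn : n ≠ 0) (he : e ≠ 0) (hen : e ⬝ᵥ n = 0) {α : ℝ}
    (hα : α * ((1 - α) * (e ⬝ᵥ (H *ᵥ (n ⨯₃ e))) -
      ((n ⨯₃ e) ⬝ᵥ (H *ᵥ (n ⨯₃ e)) - (n ⬝ᵥ n) * (e ⬝ᵥ (H *ᵥ e)))) ≠ 0)
    {u : Fin 4 → Fin 3 → ℝ} (hu : ∀ i, u i ⬝ᵥ n = 0)
    (hflex : ∀ i j, (u i - u j) ⬝ᵥ (tetraPoint n e α i - tetraPoint n e α j) = 0)
    (hsum : ∑ i, u i ⬝ᵥ (tetraCoeff α i • (H *ᵥ tetraPoint n e α i)) = 0) (i : Fin 4) :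
    u i = u 0 := by
  obtain ⟨r, hr⟩ := exists_rotation_of_tetra hn he hen α hu hflex
  have hcc : n ⨯₃ (n ⨯₃ e) = -((n ⬝ᵥ n) • e) := by
    have h : n ⨯₃ (n ⨯₃ e) = (e ⬝ᵥ n) • n - (n ⬝ᵥ n) • e := by
      ext i
      fin_cases i <;> simp [cross_apply, dotProduct, Fin.sum_univ_three] <;> ring
    rw [h, hen]; simp
  have hsymm : (n ⨯₃ e) ⬝ᵥ (H *ᵥ e) = e ⬝ᵥ (H *ᵥ (n ⨯₃ e)) := by
    have hT : Hᵀ = H := by ext i j; exact hH j i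
    rw [Matrix.dotProduct_mulVec, ← Matrix.mulVec_transpose, hT, dotProduct_comm]
  -- The translation part drops out because Σ cᵢ qᵢ = 0. What remains is `r` times Σ cᵢ (n × qᵢ) · H
  -- qᵢ, which is the displayed polynomial in `α`.
  have h1 : r * (α * ((1 - α) * (e ⬝ᵥ (H *ᵥ (n ⨯₃ e))) -
      ((n ⨯₃ e) ⬝ᵥ (H *ᵥ (n ⨯₃ e)) - (n ⬝ᵥ n) * (e ⬝ᵥ (H *ᵥ e))))) = 0 := by
    rw [Fin.sum_univ_four, hr 1, hr 2, hr 3] at hsum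
    simp [tetraCoeff, tetraPoint, hcc, Matrix.mulVec_add, Matrix.mulVec_smul, hsymm] at hsum
    linear_combination hsum
  rcases mul_eq_zero.1 h1 with h | h
  · rw [hr i, h]; simp
  · exact absurd h hα

/-- The first condition makes the lifted `K₄` leave the plane to second order, the second excludes
the rotation. The product of the two affine factors is quadratic in `α`; its vanishing at 1, 2, 3
and -1 would force `b12 = 0`. Here `b12` is the quantity that is nonzero at a point that is not
umbilic. -/
theorem exists_tetra_parameter {b11 b12 d : ℝ} (hb : b12 ≠ 0) :
    ∃ α : ℝ, α * ((1 - α) * b11 - 2 * b12) ≠ 0 ∧ α * ((1 - α) * b12 - d) ≠ 0 := by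
  by_contra! h
  have key : ∀ α : ℝ, α ≠ 0 → ((1 - α) * b11 - 2 * b12) * ((1 - α) * b12 - d) = 0 := by
    intro α hα
    by_cases h1 : (1 - α) * b11 - 2 * b12 = 0
    · rw [h1, zero_mul]
    · have := h α (mul_ne_zero hα h1)
      rw [(mul_eq_zero.1 this).resolve_left hα, mul_zero]
  have k1 := key 1 one_ne_zero
  have k2 := key 2 two_ne_zero
  have k3 := key 3 three_ne_zero
  have k4 := key (-1) (by norm_num)
  have hd : d = 0 := by
    have : b12 * d = 0 := by linarith
    exact (mul_eq_zero.1 this).resolve_left hb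
  subst hd
  have h11 : b11 * b12 = 0 := by linarith
  have h22 : b12 * b12 = 0 := by linarith
  exact hb (mul_self_eq_zero.1 h22)

end Tetrahedron

end SurfaceFramework

/-! ### Degeneration of a small tetrahedron on the surface -/

namespace SurfaceFramework

open MvPolynomial Module Filter Topology

section Degeneration

open Classical in
/-- The linear constraints with edge directions `d`, vertex normals `ν` and one extra row `τ`. -/
noncomputable def constraintMap {W : Type*} [Fintype W] (G : SimpleGraph W)
    (d : W → W → Fin 3 → ℝ) (ν τ : W → Fin 3 → ℝ) :
    (W → Fin 3 → ℝ) →ₗ[ℝ] (W → W → ℝ) × (W → ℝ) × ℝ where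
  toFun u := (fun a b => if G.Adj a b then (u a - u b) ⬝ᵥ d a b else 0, fun a => u a ⬝ᵥ ν a,
    ∑ a, u a ⬝ᵥ τ a)
  map_add' u w := by
    ext
    · simp only [Pi.add_apply, sub_dotProduct, add_dotProduct, Prod.fst_add]
      split_ifs <;> ring
    · simp
    · simp [Finset.sum_add_distrib]
  map_smul' c u := by
    ext
    · simp only [Pi.smul_apply, ← smul_sub, smul_dotProduct, Prod.smul_fst, smul_ite, smul_zero,
        RingHom.id_apply]
    · simp
    · simp [Finset.mul_sum]

theorem mem_ker_constraintMap {W : Type*} [Fintype W] {G : SimpleGraph W}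
    {d : W → W → Fin 3 → ℝ} {ν τ u : W → Fin 3 → ℝ} :
    u ∈ LinearMap.ker (constraintMap G d ν τ) ↔
      (∀ a b, G.Adj a b → (u a - u b) ⬝ᵥ d a b = 0) ∧ (∀ a, u a ⬝ᵥ ν a = 0) ∧
        ∑ a, u a ⬝ᵥ τ a = 0 := by
  simp only [LinearMap.mem_ker, constraintMap, LinearMap.coe_mk, AddHom.coe_mk, Prod.ext_iff,
    Prod.fst_zero, Prod.snd_zero, funext_iff, Pi.zero_apply, ite_eq_right_iff]

theorem continuous_constraintMap {W Θ : Type*} [Fintype W] [TopologicalSpace Θ]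
    (G : SimpleGraph W) {d : Θ → W → W → Fin 3 → ℝ} {ν τ : Θ → W → Fin 3 → ℝ}
    (hd : ∀ a b, Continuous fun θ => d θ a b) (hν : ∀ a, Continuous fun θ => ν θ a)
    (hτ : ∀ a, Continuous fun θ => τ θ a) (u : W → Fin 3 → ℝ) :
    Continuous fun θ => constraintMap G (d θ) (ν θ) (τ θ) u := by
  refine Continuous.prodMk (continuous_pi fun a => continuous_pi fun b => ?_)
    (Continuous.prodMk (continuous_pi fun a => ?_) (continuous_finsetSum _ fun a _ => ?_))
  · split_ifs
    · exact continuous_const.dotProduct (hd a b)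
    · exact continuous_const
  · exact continuous_const.dotProduct (hν a)
  · exact continuous_const.dotProduct (hτ a)

/-- A stress of rank one on four points whose affine combination is normal. -/
theorem sum_stress_eq_zero {c : Fin 4 → ℝ} (hc : ∑ i, c i = 0) {p u : Fin 4 → Fin 3 → ℝ}
    (hflex : ∀ i j, (u i - u j) ⬝ᵥ (p i - p j) = 0) :
    (∑ i, c i • u i) ⬝ᵥ (∑ i, c i • p i) = 0 := by
  have h01 := hflex 0 1
  have h02 := hflex 0 2
  have h03 := hflex 0 3
  have h12 := hflex 1 2
  have h13 := hflex 1 3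
  have h23 := hflex 2 3
  rw [Fin.sum_univ_four] at hc
  obtain h0 : c 0 = -(c 1 + c 2 + c 3) := by linarith
  simp only [Fin.sum_univ_four, h0]
  simp only [add_dotProduct, dotProduct_add, smul_dotProduct, dotProduct_smul, sub_dotProduct,
    dotProduct_sub, smul_eq_mul] at *
  linear_combination (c 1 + c 2 + c 3) * c 1 * h01 + (c 1 + c 2 + c 3) * c 2 * h02
    + (c 1 + c 2 + c 3) * c 3 * h03 - c 1 * c 2 * h12 - c 1 * c 3 * h13 - c 2 * c 3 * h23

variable {V : Type*} [Fintype V] {m : MvPolynomial (Fin 3) ℚ} {M : Set (Fin 3 → ℝ)}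

/-- Blowing up a vertex at a point that is not umbilic to a small `K₄` does not increase the
dimension of the flex space. -/
theorem exists_placement_vertexToK4 (hM : IsIrreducibleSurface m M) (G : SimpleGraph V) (v : V)
    (f : V → Fin 4) {p : V → Fin 3 → ℝ} (hp : ∀ x, p x ∈ M) {e : Fin 3 → ℝ}
    (hen : e ⬝ᵥ normal m (p v) = 0)
    (humb : e ⬝ᵥ (hessian m (p v) *ᵥ (normal m (p v) ⨯₃ e)) ≠ 0) :
    ∃ p' : {x : V // x ≠ v} ⊕ Fin 4 → Fin 3 → ℝ, (∀ w, p' w ∈ M) ∧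
      finrank ℝ (flexSpace m (vertexToK4 G v f) p') ≤ finrank ℝ (flexSpace m G p) := by
  classical
  obtain ⟨U, hU, hMU⟩ := hM.isSurface
  have hx : p v ∈ regularZeros m := hM.subset (hp v)
  obtain ⟨E, hE, hE0, hE1⟩ := exists_normal_expansion m (p v)
  set x₀ := p v with hx₀
  set n := normal m x₀ with hn
  set H := hessian m x₀ with hH
  have hn0 : n ≠ 0 := hx.2
  have he0 : e ≠ 0 := by rintro rfl; simp at humb
  have hNpos : n ⬝ᵥ n ≠ 0 := fun h => hn0 (dotProduct_self_eq_zero.1 h)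
  obtain ⟨α, hα1, hα2⟩ := exists_tetra_parameter (b11 := e ⬝ᵥ (H *ᵥ e))
    (d := (n ⨯₃ e) ⬝ᵥ (H *ᵥ (n ⨯₃ e)) - (n ⬝ᵥ n) * (e ⬝ᵥ (H *ᵥ e))) humb
  set q := tetraPoint n e α with hq
  have hqn : ∀ i, q i ⬝ᵥ n = 0 := tetraPoint_dotProduct hen α
  set c := tetraCoeff α with hcdef
  let s₀ : Fin 4 → ℝ := fun i => -(q i ⬝ᵥ (H *ᵥ q i)) / (2 * (n ⬝ᵥ n))
  -- The `s₀ i` are the limiting normal heights of the surface over the points `q i`, in units of t²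
  -- and `n`. The claim is that the four lifted points violate the affine dependency.
  have hs₀ : ∑ i, c i * s₀ i ≠ 0 := by
    have hsymm : (n ⨯₃ e) ⬝ᵥ (H *ᵥ e) = e ⬝ᵥ (H *ᵥ (n ⨯₃ e)) := by
      have hT : Hᵀ = H := by ext i j; exact hessian_symm m _ _ _
      rw [Matrix.dotProduct_mulVec, ← Matrix.mulVec_transpose, hT, dotProduct_comm]
    have : ∑ i, c i * s₀ i = -(α * ((1 - α) * (e ⬝ᵥ (H *ᵥ e)) - 2 * (e ⬝ᵥ (H *ᵥ (n ⨯₃ e)))))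
        / (2 * (n ⬝ᵥ n)) := by
      simp [Fin.sum_univ_four, c, s₀, q, tetraCoeff, tetraPoint, Matrix.mulVec_add,
        Matrix.mulVec_smul, hsymm]
      field_simp
      ring
    rw [this]
    exact div_ne_zero (neg_ne_zero.2 hα1) (mul_ne_zero two_ne_zero hNpos)
  -- The family of placements and its rescaled constraints.
  let dir : ℝ × (Fin 4 → ℝ) → Fin 4 → Fin 3 → ℝ := fun θ i => q i + (θ.1 * θ.2 i) • n
  let P : ℝ × (Fin 4 → ℝ) → ({x : V // x ≠ v} ⊕ Fin 4) → Fin 3 → ℝ := fun θ w => Sum.elim (fun x : {x : V // x ≠ v} => p x) (fun i => x₀ + θ.1 • dir θ i) w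
  -- Edges inside the `K₄` shrink with `t`, so their directions are divided by `t` to keep the
  -- nonzero limits qᵢ - qⱼ. All other edges keep their true direction.
  let d : ℝ × (Fin 4 → ℝ) → ({x : V // x ≠ v} ⊕ Fin 4) → ({x : V // x ≠ v} ⊕ Fin 4) → Fin 3 → ℝ := fun θ a b =>
    match a, b with
    | Sum.inr i, Sum.inr j => dir θ i - dir θ j
    | a, b => P θ a - P θ b
  let ν : ℝ × (Fin 4 → ℝ) → ({x : V // x ≠ v} ⊕ Fin 4) → Fin 3 → ℝ := fun θ w => normal m (P θ w)
  -- The extra row carries the second-order condition. Its limit at `t = 0` has entries cᵢ H qᵢ.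
  let τ : ℝ × (Fin 4 → ℝ) → ({x : V // x ≠ v} ⊕ Fin 4) → Fin 3 → ℝ := fun θ w =>
    Sum.elim (fun _ => 0) (fun i => c i • E (θ.1, dir θ i)) w
  let G' : SimpleGraph ({x : V // x ≠ v} ⊕ Fin 4) := vertexToK4 G v f
  let L : ℝ × (Fin 4 → ℝ) → (({x : V // x ≠ v} ⊕ Fin 4) → Fin 3 → ℝ) →ₗ[ℝ] (({x : V // x ≠ v} ⊕ Fin 4) → ({x : V // x ≠ v} ⊕ Fin 4) → ℝ) × (({x : V // x ≠ v} ⊕ Fin 4) → ℝ) × ℝ :=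
    fun θ => constraintMap G' (d θ) (ν θ) (τ θ)
  have hdir : ∀ i, Continuous fun θ => dir θ i := fun i => by
    simp only [dir]; fun_prop
  have hP : ∀ w, Continuous fun θ => P θ w := by
    rintro (x | i)
    · exact continuous_const
    · exact continuous_const.add (continuous_fst.smul (hdir i))
  have hL : ∀ u, Continuous fun θ => L θ u := by
    refine continuous_constraintMap G' ?_ ?_ ?_
    · rintro (x | i) (y | j)
      · exact (hP _).sub (hP _)
      · exact (hP _).sub (hP _)
      · exact (hP _).sub (hP _)
      · exact (hdir i).sub (hdir j)
    · exact fun w => (continuous_normal m).comp (hP w)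
    · rintro (x | i)
      · exact continuous_const
      · exact (hE.comp (continuous_fst.prodMk (hdir i))).const_smul (c i)
  let θ₀ : ℝ × (Fin 4 → ℝ) := (0, s₀)
  -- The limit of the constraints forces the velocities on `K₄` to agree.
  have hlimit : finrank ℝ (LinearMap.ker (L θ₀)) ≤ finrank ℝ (flexSpace m G p) := by
    have hagree : ∀ u ∈ LinearMap.ker (L θ₀), ∀ i, u (Sum.inr i) = u (Sum.inr 0) := by
      intro u hu i
      obtain ⟨h1, h2, h3⟩ := mem_ker_constraintMap.1 hu
      refine eq_of_tetra_flex (u := fun i => u (Sum.inr i)) (H := H) (hessian_symm m _) hn0 he0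
        hen hα2 (fun i => ?_) (fun i j => ?_) ?_ i
      · have := h2 (Sum.inr i)
        simpa [ν, P, θ₀] using this
      · by_cases hij : i = j
        · simp [hij]
        · have := h1 (Sum.inr i) (Sum.inr j) hij
          simpa [d, dir, θ₀] using this
      · rw [Fintype.sum_sum_type] at h3
        simpa [τ, dir, θ₀, hE0] using h3
    let g : V → ({x : V // x ≠ v} ⊕ Fin 4) := fun x => if h : x = v then Sum.inr 0 else Sum.inl ⟨x, h⟩
    have hgv : g v = Sum.inr 0 := by simp [g]
    have hg : ∀ x (h : x ≠ v), g x = Sum.inl ⟨x, h⟩ := fun x h => by simp [g, h]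
    have hmap : ∀ u ∈ LinearMap.ker (L θ₀), LinearMap.funLeft ℝ (Fin 3 → ℝ) g u ∈
        flexSpace m G p := by
      intro u hu
      obtain ⟨h1, h2, h3⟩ := mem_ker_constraintMap.1 hu
      have hstar : ∀ x (h : x ≠ v), G.Adj x v →
          (u (Sum.inl ⟨x, h⟩) - u (Sum.inr 0)) ⬝ᵥ (p x - p v) = 0 := by
        intro x h hxv
        have := h1 (Sum.inl ⟨x, h⟩) (Sum.inr (f x)) ⟨hxv, rfl⟩
        rw [hagree u hu] at this
        simpa [d, P, θ₀] using this
      refine ⟨fun x => ?_, fun x y hxy => ?_⟩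
      · rw [LinearMap.funLeft_apply]
        by_cases h : x = v
        · subst h
          rw [hgv]
          simpa [ν, P, θ₀] using h2 (Sum.inr 0)
        · rw [hg x h]
          exact h2 (Sum.inl ⟨x, h⟩)
      · rw [LinearMap.funLeft_apply, LinearMap.funLeft_apply, ← sub_eq_zero, ← sub_dotProduct]
        by_cases h : x = v
        · subst h
          have hy : y ≠ x := hxy.ne'
          rw [hgv, hg y hy]
          have := hstar y hy hxy.symm
          rw [← neg_sub (p y), dotProduct_neg, ← neg_dotProduct, neg_sub]
          exact this
        · by_cases h' : y = v
          · subst h'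
            rw [hgv, hg x h]
            exact hstar x h hxy
          · rw [hg x h, hg y h']
            exact h1 (Sum.inl ⟨x, h⟩) (Sum.inl ⟨y, h'⟩) hxy
    refine LinearMap.finrank_le_finrank_of_injective
      (f := (LinearMap.funLeft ℝ (Fin 3 → ℝ) g).restrict hmap) ?_
    rw [← LinearMap.ker_eq_bot, LinearMap.ker_eq_bot']
    rintro ⟨u, hu⟩ h0
    have h0' : ∀ x, u (g x) = 0 := fun x => congrFun (congrArg Subtype.val h0) x
    refine Subtype.ext (funext fun w => ?_)
    rcases w with ⟨x, hx⟩ | i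
    · rw [← hg x hx]; exact h0' x
    · exact (hagree u hu i).trans (by rw [← hgv]; exact h0' v)
  -- Off the limit the extra row follows from the others: the stress gives Σ cᵢ uᵢ · n = 0, and
  -- inserting the tangency conditions at the displaced points leaves `t` times the extra row.
  have hkey : ∀ θ : ℝ × (Fin 4 → ℝ), θ.1 ≠ 0 → ∑ i, c i * θ.2 i ≠ 0 →
      flexSpace m G' (P θ) ≤ LinearMap.ker (L θ) := by
    intro θ ht hs u hu
    have hK4 : ∀ i j : Fin 4, (u (Sum.inr i) - u (Sum.inr j)) ⬝ᵥ (dir θ i - dir θ j) = 0 := by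
      intro i j
      by_cases hij : i = j
      · simp [hij]
      · have h1 := hu.2 (Sum.inr i) (Sum.inr j) hij
        rw [← sub_eq_zero, ← sub_dotProduct] at h1
        have h2 : P θ (Sum.inr i) - P θ (Sum.inr j) = θ.1 • (dir θ i - dir θ j) := by
          simp only [P, Sum.elim_inr]; module
        rw [h2, dotProduct_smul, smul_eq_mul] at h1
        exact (mul_eq_zero.1 h1).resolve_left ht
    refine mem_ker_constraintMap.2 ⟨?_, fun w => hu.1 w, ?_⟩
    · rintro (x | i) (y | j) hab
      · rw [sub_dotProduct, sub_eq_zero]; exact hu.2 _ _ hab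
      · rw [sub_dotProduct, sub_eq_zero]; exact hu.2 _ _ hab
      · rw [sub_dotProduct, sub_eq_zero]; exact hu.2 _ _ hab
      · exact hK4 i j
    · have hst := sum_stress_eq_zero (c := c) (sum_tetraCoeff α) hK4
      have hdirsum : ∑ i, c i • dir θ i = (θ.1 * ∑ i, c i * θ.2 i) • n := by
        simp only [dir, smul_add, Finset.sum_add_distrib, Finset.mul_sum, Finset.sum_smul]
        rw [sum_tetraCoeff_smul, zero_add]
        refine Finset.sum_congr rfl fun i _ => ?_
        rw [smul_smul]; congr 1; ring
      rw [hdirsum, dotProduct_smul, smul_eq_mul] at hst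
      have hst' := (mul_eq_zero.1 hst).resolve_left (mul_ne_zero ht hs)
      rw [sum_dotProduct] at hst'
      have hnorm : ∀ i, u (Sum.inr i) ⬝ᵥ n + θ.1 * (u (Sum.inr i) ⬝ᵥ E (θ.1, dir θ i)) = 0 := by
        intro i
        have h1 : u (Sum.inr i) ⬝ᵥ normal m (x₀ + θ.1 • dir θ i) = 0 := hu.1 (Sum.inr i)
        rwa [hE1, dotProduct_add, dotProduct_smul, smul_eq_mul] at h1
      rw [Fintype.sum_sum_type]
      simp only [τ, Sum.elim_inl, Sum.elim_inr, dotProduct_zero, Finset.sum_const_zero, zero_add,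
        dotProduct_smul, smul_eq_mul]
      have h2 : θ.1 * ∑ i, c i * (u (Sum.inr i) ⬝ᵥ E (θ.1, dir θ i)) = 0 := by
        rw [Finset.mul_sum, ← neg_eq_zero, ← Finset.sum_neg_distrib, ← hst']
        refine Finset.sum_congr rfl fun i _ => ?_
        rw [smul_dotProduct, smul_eq_mul]
        linear_combination (-c i) * hnorm i
      exact (mul_eq_zero.1 h2).resolve_left ht
  -- Choose a parameter close to the limit for which the placement lies on the surface.
  have hgood : ∀ᶠ θ in 𝓝 θ₀, finrank ℝ (LinearMap.ker (L θ)) ≤ finrank ℝ (LinearMap.ker (L θ₀)) ∧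
      ∑ i, c i * θ.2 i ≠ 0 ∧ ∀ i, P θ (Sum.inr i) ∈ U ∧ normal m (P θ (Sum.inr i)) ≠ 0 := by
    have hPθ₀ : ∀ i, P θ₀ (Sum.inr i) = x₀ := fun i => by simp [P, θ₀]
    refine (eventually_finrank_ker_le L hL θ₀).and (Eventually.and ?_ (eventually_all.2 fun i =>
      Eventually.and ?_ ?_))
    · exact ContinuousAt.eventually_ne (g := fun θ : ℝ × (Fin 4 → ℝ) => ∑ i, c i * θ.2 i)
        (by fun_prop) hs₀
    · refine (hP (Sum.inr i)).continuousAt.eventually (hU.mem_nhds ?_)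
      beta_reduce
      rw [hPθ₀]
      have := hp v
      rw [hMU] at this
      exact this.1
    · refine ContinuousAt.eventually_ne ((continuous_normal m).comp (hP _)).continuousAt ?_
      rw [hPθ₀]
      exact hn0
  rw [Metric.eventually_nhds_iff] at hgood
  obtain ⟨ε, hε, hgood⟩ := hgood
  -- Heights within ε/2 of `s₀` keep (t, s) inside the ε-ball, in the maximum metric, on which all
  -- the open conditions hold.
  have hroots : ∀ᶠ t in 𝓝 (0 : ℝ), ∀ i, t ≠ 0 → ∃ s, |s - s₀ i| ≤ ε / 2 ∧
      aeval (x₀ + t • (q i + (t * s) • n)) m = 0 :=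
    eventually_all.2 fun i => eventually_exists_zero m hx (hqn i) (half_pos hε)
  obtain ⟨ρ, hρ, hroots⟩ := Metric.eventually_nhds_iff.1 hroots
  set t := min ρ ε / 2 with ht
  have htpos : 0 < t := half_pos (lt_min hρ hε)
  have htρ : t < ρ := by have := min_le_left ρ ε; linarith
  have htε : t < ε := by have := min_le_right ρ ε; linarith
  have hdt : dist t 0 = t := by rw [Real.dist_0_eq_abs, abs_of_pos htpos]
  choose s hs hzero using fun i => hroots (hdt.trans_lt htρ) i htpos.ne'
  have hdist : dist ((t, s) : ℝ × (Fin 4 → ℝ)) θ₀ < ε := by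
    rw [Prod.dist_eq]
    refine max_lt (hdt.trans_lt htε) (lt_of_le_of_lt ?_ (half_lt_self hε))
    exact (dist_pi_le_iff (half_pos hε).le).2 fun i => by rw [Real.dist_eq]; exact hs i
  obtain ⟨g1, g2, g3⟩ := hgood hdist
  refine ⟨P (t, s), ?_, ?_⟩
  · rintro (x | i)
    · exact hp x
    · rw [hMU]
      exact ⟨(g3 i).1, hzero i, (g3 i).2⟩
  · exact ((Submodule.finrank_mono (hkey (t, s) htpos.ne' g2)).trans g1).trans hlimit

end Degeneration

end SurfaceFramework

/-! ### Edge counts, rigid motions, and transfer from `G` to `G'` -/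

namespace SurfaceFramework

open MvPolynomial Module

section EdgeCount

variable {V : Type*} (G : SimpleGraph V) (v : V) (f : V → Fin 4)

/-- Only the upper bound is needed: the rank is shown to be large enough, and it never exceeds the
number of rows. -/
theorem card_edgeSet_vertexToK4_le [Finite V] :
    Nat.card (vertexToK4 G v f).edgeSet ≤ Nat.card G.edgeSet + 6 := by
  classical
  let g : V → V → {x : V // x ≠ v} ⊕ Fin 4 := fun a b =>
    if h : a = v then Sum.inr (f b) else Sum.inl ⟨a, h⟩
  let φ : Sym2 V → Sym2 ({x : V // x ≠ v} ⊕ Fin 4) :=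
    Sym2.lift ⟨fun a b => s(g a b, g b a), fun a b => Sym2.eq_swap⟩
  have hsub : (vertexToK4 G v f).edgeSet ⊆
      φ '' G.edgeSet ∪ Sym2.map Sum.inr '' (⊤ : SimpleGraph (Fin 4)).edgeSet := by
    intro e he
    induction e using Sym2.ind with
    | _ a b =>
      rcases a with ⟨x, hx⟩ | i <;> rcases b with ⟨y, hy⟩ | j
      · exact Or.inl ⟨s(x, y), he, by simp [φ, g, hx, hy]⟩
      · obtain ⟨h1, h2⟩ : G.Adj x v ∧ f x = j := he
        exact Or.inl ⟨s(x, v), h1, by simp [φ, g, hx, h2]⟩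
      · obtain ⟨h1, h2⟩ : G.Adj y v ∧ f y = i := he
        exact Or.inl ⟨s(v, y), h1.symm, by simp [φ, g, hy, h2]⟩
      · exact Or.inr ⟨s(i, j), he, by simp⟩
  have h6 : (⊤ : SimpleGraph (Fin 4)).edgeSet.ncard = 6 := by
    rw [← SimpleGraph.coe_edgeFinset, Set.ncard_coe_finset,
      SimpleGraph.card_edgeFinset_top_eq_card_choose_two]
    rfl
  rw [Nat.card_coe_set_eq, Nat.card_coe_set_eq]
  calc _ ≤ _ := Set.ncard_le_ncard hsub
    _ ≤ _ := Set.ncard_union_le _ _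
    _ ≤ _ := add_le_add (Set.ncard_image_le (Set.toFinite _))
      ((Set.ncard_image_le (Set.toFinite _)).trans h6.le)

end EdgeCount

section RigidMotions

variable {V : Type*} (m : MvPolynomial (Fin 3) ℚ) (M : Set (Fin 3 → ℝ))

/-- The pairs `(a, b)` encoding infinitesimal isometries tangential to the surface. -/
def rigidMotions : Submodule ℝ ((Fin 3 → ℝ) × (Fin 3 → ℝ)) where
  carrier := {c | IsRigidMotion m M c.1 c.2}
  add_mem' := by
    intro c d hc hd x hx
    have h1 := hc x hx
    have h2 := hd x hx
    simp only [add_dotProduct, Prod.fst_add, Prod.snd_add, map_add, LinearMap.add_apply] at *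
    linarith
  zero_mem' := by
    intro x _
    simp
  smul_mem' := by
    intro r c hc x hx
    have h1 := hc x hx
    simp only [add_dotProduct, Prod.smul_fst, Prod.smul_snd, map_smul, LinearMap.smul_apply,
      smul_dotProduct, smul_eq_mul] at *
    rw [← mul_add, h1, mul_zero]

/-- The velocities of a placement under an infinitesimal isometry. -/
def motionMap (p : V → Fin 3 → ℝ) :
    (Fin 3 → ℝ) × (Fin 3 → ℝ) →ₗ[ℝ] (V → Fin 3 → ℝ) where
  toFun c := fun v => c.1 ⨯₃ p v + c.2
  map_add' c d := by
    ext v i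
    simp only [Prod.fst_add, Prod.snd_add, map_add, LinearMap.add_apply, Pi.add_apply]
    ring
  map_smul' r c := by
    ext v i
    simp only [Prod.smul_fst, Prod.smul_snd, map_smul, LinearMap.smul_apply, Pi.add_apply,
      Pi.smul_apply, RingHom.id_apply, smul_eq_mul]
    ring

variable {m M}

theorem map_motionMap_le {G : SimpleGraph V} {p : V → Fin 3 → ℝ} (hp : ∀ v, p v ∈ M) :
    (rigidMotions m M).map (motionMap p) ≤ flexSpace m G p := by
  rintro _ ⟨c, hc, rfl⟩
  refine ⟨fun v => hc _ (hp v), fun v w _ => ?_⟩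
  have h : c.1 ⨯₃ p v + c.2 - (c.1 ⨯₃ p w + c.2) = c.1 ⨯₃ (p v - p w) := by
    rw [map_sub]; abel
  rw [← sub_eq_zero, ← sub_dotProduct]
  change (c.1 ⨯₃ p v + c.2 - (c.1 ⨯₃ p w + c.2)) ⬝ᵥ (p v - p w) = 0
  rw [h, dotProduct_comm, dot_cross_self]

theorem isInfinitesimallyRigid_iff {G : SimpleGraph V} {p : V → Fin 3 → ℝ} :
    IsInfinitesimallyRigid m M G p ↔
      flexSpace m G p ≤ (rigidMotions m M).map (motionMap p) := by
  constructor
  · intro h u hu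
    obtain ⟨a, b, hab, huab⟩ := h u hu
    exact ⟨(a, b), hab, funext fun v => (huab v).symm⟩
  · intro h u hu
    obtain ⟨c, hc, rfl⟩ := h hu
    exact ⟨c.1, c.2, hc, fun v => rfl⟩

/-- Trivial motions of a restricted placement are restrictions of trivial motions. No injectivity of
`motionMap` is needed, so degenerate point sets cause no exception. -/
theorem finrank_map_motionMap_comp_le {W : Type*} [Finite V] [Finite W] (p : V → Fin 3 → ℝ)
    (g : W → V) :
    finrank ℝ ((rigidMotions m M).map (motionMap (p ∘ g))) ≤
      finrank ℝ ((rigidMotions m M).map (motionMap p)) := by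
  have : motionMap (p ∘ g) = LinearMap.funLeft ℝ (Fin 3 → ℝ) g ∘ₗ motionMap p := rfl
  rw [this, Submodule.map_comp]
  exact Submodule.finrank_map_le _ _

end RigidMotions

section Transfer

variable {V : Type*} {m : MvPolynomial (Fin 3) ℚ} {M : Set (Fin 3 → ℝ)}
  {G : SimpleGraph V} {v : V} {f : V → Fin 4}

/-- The embedding of the old vertices that sends `v` to the first vertex of the new `K₄`. -/
noncomputable def vertexEmbedding (v : V) : V → {x : V // x ≠ v} ⊕ Fin 4 :=
  open Classical in fun x => if h : x = v then Sum.inr 0 else Sum.inl ⟨x, h⟩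

theorem leftInverse_vertexEmbedding (v : V) :
    Function.LeftInverse (Sum.elim Subtype.val fun _ => v) (vertexEmbedding v) := by
  intro x
  by_cases h : x = v <;> simp [vertexEmbedding, h]

theorem vertexEmbedding_self (v : V) : vertexEmbedding v v = Sum.inr 0 := by
  simp [vertexEmbedding]

variable [Fintype V]

/-- A generic placement of the new graph restricts to a generic placement of the old graph,
and its flex space is not larger if the first point of `K₄` is not umbilic. -/
theorem finrank_flexSpace_vertexToK4_le (hM : IsIrreducibleSurface m M)
    {p' : {x : V // x ≠ v} ⊕ Fin 4 → Fin 3 → ℝ} (hp' : IsGeneric m M p')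
    (humb : ∃ e, e ⬝ᵥ normal m (p' (Sum.inr 0)) = 0 ∧
      e ⬝ᵥ (hessian m (p' (Sum.inr 0)) *ᵥ (normal m (p' (Sum.inr 0)) ⨯₃ e)) ≠ 0) :
    finrank ℝ (flexSpace m (vertexToK4 G v f) p') ≤
      finrank ℝ (flexSpace m G (p' ∘ vertexEmbedding v)) := by
  classical
  obtain ⟨e, he1, he2⟩ := humb
  rw [← vertexEmbedding_self] at he1 he2
  obtain ⟨q, hq, hle⟩ := exists_placement_vertexToK4 hM G v f
    (p := p' ∘ vertexEmbedding v) (fun x => hp'.1 _) he1 he2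
  exact (hp'.finrank_flexSpace_le fun w => (hM.subset (hq w)).1).trans hle

/-- Flexes of `G'` are bounded in dimension by flexes of `G`, these by trivial motions of the
restricted placement, and these by trivial motions of `p'`, which are themselves flexes of `G'`.
Equality holds throughout. -/
theorem isInfinitesimallyRigid_vertexToK4 (hM : IsIrreducibleSurface m M)
    (hG : GenericallyRigid m M G)
    {p' : {x : V // x ≠ v} ⊕ Fin 4 → Fin 3 → ℝ} (hp' : IsGeneric m M p')
    (humb : ∃ e, e ⬝ᵥ normal m (p' (Sum.inr 0)) = 0 ∧
      e ⬝ᵥ (hessian m (p' (Sum.inr 0)) *ᵥ (normal m (p' (Sum.inr 0)) ⨯₃ e)) ≠ 0) :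
    IsInfinitesimallyRigid m M (vertexToK4 G v f) p' := by
  classical
  have h1 := isInfinitesimallyRigid_iff.1
    (hG _ (hp'.comp (leftInverse_vertexEmbedding v)))
  refine isInfinitesimallyRigid_iff.2 (Submodule.eq_of_le_of_finrank_le
    (map_motionMap_le hp'.1) ?_).ge
  exact (finrank_flexSpace_vertexToK4_le hM hp' humb).trans
    ((Submodule.finrank_mono h1).trans (finrank_map_motionMap_comp_le _ _))

/-- The columns increase by 9 and the flex dimension does not, so the rank increases by at least 9.
The rows increase by at most 6 edges and 3 vertices. -/
theorem isIndependent_vertexToK4 (hM : IsIrreducibleSurface m M)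
    (hG : GenericallyIndependent m M G)
    {p' : {x : V // x ≠ v} ⊕ Fin 4 → Fin 3 → ℝ} (hp' : IsGeneric m M p')
    (humb : ∃ e, e ⬝ᵥ normal m (p' (Sum.inr 0)) = 0 ∧
      e ⬝ᵥ (hessian m (p' (Sum.inr 0)) *ᵥ (normal m (p' (Sum.inr 0)) ⨯₃ e)) ≠ 0) :
    IsIndependent m (vertexToK4 G v f) p' := by
  classical
  have h1 := isIndependent_iff_rank.1 (hG _ (hp'.comp (leftInverse_vertexEmbedding v)))
  have h2 := finrank_flexSpace_vertexToK4_le (G := G) (f := f) hM hp' humb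
  have h3 := rank_add_finrank_flexSpace (m := m) (G := G) (p := p' ∘ vertexEmbedding v)
  have h4 := rank_add_finrank_flexSpace (m := m) (G := vertexToK4 G v f) (p := p')
  have h5 := card_edgeSet_vertexToK4_le G v f
  have h6 := rank_le_card (m := m) (G := vertexToK4 G v f) (p := p')
  have h7 : Fintype.card ({x : V // x ≠ v} ⊕ Fin 4) = Fintype.card V + 3 := by
    have : 0 < Fintype.card V := Fintype.card_pos_iff.2 ⟨v⟩
    rw [Fintype.card_sum, Fintype.card_subtype_compl, Fintype.card_subtype_eq, Fintype.card_fin]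
    omega
  rw [isIndependent_iff_rank]
  omega

end Transfer

section Isomorphism

variable {V W : Type*} {m : MvPolynomial (Fin 3) ℚ} {M : Set (Fin 3 → ℝ)}
  {G : SimpleGraph V} {G' : SimpleGraph W}

theorem IsInfinitesimalFlex.comp_iso (φ : G ≃g G') {p u : W → Fin 3 → ℝ}
    (hu : IsInfinitesimalFlex m G' p u) : IsInfinitesimalFlex m G (p ∘ φ) (u ∘ φ) :=
  ⟨fun v => hu.1 (φ v), fun v w h => hu.2 (φ v) (φ w) (φ.map_adj_iff.2 h)⟩

theorem finrank_flexSpace_comp_iso_le [Finite V] (φ : G ≃g G') (p : W → Fin 3 → ℝ) :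
    finrank ℝ (flexSpace m G' p) ≤ finrank ℝ (flexSpace m G (p ∘ φ)) := by
  refine LinearMap.finrank_le_finrank_of_injective
    (f := (LinearMap.funLeft ℝ (Fin 3 → ℝ) φ).restrict fun u hu =>
      IsInfinitesimalFlex.comp_iso φ hu) ?_
  intro a b hab
  exact Subtype.ext
    (LinearMap.funLeft_injective_of_surjective ℝ (Fin 3 → ℝ) φ φ.surjective (congrArg Subtype.val hab))

theorem IsInfinitesimallyRigid.of_iso (φ : G ≃g G') {p : W → Fin 3 → ℝ}
    (h : IsInfinitesimallyRigid m M G (p ∘ φ)) : IsInfinitesimallyRigid m M G' p := by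
  intro u hu
  obtain ⟨a, b, hab, huab⟩ := h (u ∘ φ) (hu.comp_iso φ)
  refine ⟨a, b, hab, fun w => ?_⟩
  simpa using huab (φ.symm w)

theorem IsIndependent.of_iso [Fintype V] [Fintype W] (φ : G ≃g G') {p : W → Fin 3 → ℝ}
    (h : IsIndependent m G (p ∘ φ)) : IsIndependent m G' p := by
  have h1 := isIndependent_iff_rank.1 h
  have h2 := finrank_flexSpace_comp_iso_le (m := m) φ p
  have h3 := rank_add_finrank_flexSpace (m := m) (G := G) (p := p ∘ φ)
  have h4 := rank_add_finrank_flexSpace (m := m) (G := G') (p := p)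
  have h5 := rank_le_card (m := m) (G := G') (p := p)
  have h6 : Nat.card G.edgeSet = Nat.card G'.edgeSet := Nat.card_congr φ.mapEdgeSet
  have h7 : Fintype.card V = Fintype.card W := Fintype.card_congr φ.toEquiv
  rw [isIndependent_iff_rank]
  omega

end Isomorphism

end SurfaceFramework

/-! ### Derivations of the function field -/

namespace SurfaceFramework

open MvPolynomial Module

section DerivationField

/-- The chain rule for a derivation applied to the value of a polynomial. -/
theorem derivation_aeval {σ K : Type*} [Fintype σ] [Field K] [Algebra ℚ K] (D : Derivation ℚ K K)
    (ξ : σ → K) (F : MvPolynomial σ ℚ) :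
    D (aeval ξ F) = ∑ i, aeval ξ (pderiv i F) * D (ξ i) := by
  classical
  induction F using MvPolynomial.induction_on with
  | C a => rw [aeval_C, Derivation.map_algebraMap]; simp
  | add p q hp hq => simp [hp, hq, add_mul, Finset.sum_add_distrib]
  | mul_X p i hp =>
    simp only [map_mul, aeval_X, Derivation.leibniz, hp, smul_eq_mul, map_add, pderiv_X, add_mul,
      Finset.sum_add_distrib, Finset.mul_sum]
    congr 1
    · simp [Pi.single_apply]
    · exact Finset.sum_congr rfl fun j _ => by ring

variable {K : Type*} [Field K] [Algebra ℚ K]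

/-- Elements killed by two independent derivations in a field of transcendence degree two are
algebraic. -/
theorem isAlgebraic_of_derivation_eq_zero {ξ : Fin 3 → K}
    (hgen : Algebra.IsAlgebraic (Algebra.adjoin ℚ (Set.range ξ)) K)
    (hdep : ¬ AlgebraicIndependent ℚ ξ) {D₁ D₂ : Derivation ℚ K K} {x y a : K}
    (h11 : D₁ x = 1) (h12 : D₁ y = 0) (h21 : D₂ x = 0) (h22 : D₂ y = 1)
    (h1 : D₁ a = 0) (h2 : D₂ a = 0) : IsAlgebraic ℚ a := by
  classical
  -- Three independent elements would force the three elements `ξ`, over which the field is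
  -- algebraic, to be a transcendence basis.
  have hdep' : ¬ AlgebraicIndependent ℚ ![a, x, y] := by
    intro h
    have hle := h.lift_cardinalMk_le_trdeg
    have : IsTranscendenceBasis ℚ ξ :=
      Algebra.IsAlgebraic.isTranscendenceBasis_of_lift_le_trdeg_of_finite ℚ ξ hle
    exact hdep this.1
  rw [algebraicIndependent_iff] at hdep'
  push Not at hdep'
  -- Take a relation `P(a, x, y) = 0` of least degree. Applying `D₁` and `D₂` shows that its partial
  -- derivatives in `x` and `y` vanish at the point, hence identically by minimality. In
  -- characteristic zero `P` then involves `a` alone.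
  have hex : ∃ d, ∃ P : MvPolynomial (Fin 3) ℚ, aeval ![a, x, y] P = 0 ∧ P ≠ 0 ∧
      P.totalDegree = d := by
    obtain ⟨P, hP, hP0⟩ := hdep'
    exact ⟨_, P, hP, hP0, rfl⟩
  obtain ⟨P, hP, hP0, hd⟩ := Nat.find_spec hex
  have hmin : ∀ i, aeval ![a, x, y] (pderiv i P) = 0 → pderiv i P = 0 := by
    intro i hi
    by_contra hne
    refine Nat.find_min hex ?_ ⟨pderiv i P, hi, hne, rfl⟩
    rw [← hd]
    obtain ⟨s, hs, hs'⟩ : ∃ s ∈ (pderiv i P).support, (s.sum fun _ e => e) =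
        (pderiv i P).totalDegree := by
      obtain ⟨s, hs, h⟩ := Finset.exists_mem_eq_sup (pderiv i P).support
        (support_nonempty.2 hne) (fun s => s.sum fun _ e => e)
      exact ⟨s, hs, h.symm⟩
    have hc : s + Finsupp.single i 1 ∈ P.support := by
      rw [MvPolynomial.mem_support_iff] at hs ⊢
      rw [coeff_pderiv] at hs
      exact left_ne_zero_of_mul hs
    have hle := le_totalDegree hc
    rw [Finsupp.sum_add_index' (fun _ => rfl) (fun _ _ _ => rfl), Finsupp.sum_single_index rfl,
      hs'] at hle
    omega
  have d1 := derivation_aeval D₁ ![a, x, y] P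
  have d2 := derivation_aeval D₂ ![a, x, y] P
  rw [hP, map_zero] at d1 d2
  simp only [Fin.sum_univ_three, Matrix.cons_val, h1, h2, h11, h12, h21, h22, mul_zero, mul_one,
    zero_add, add_zero] at d1 d2
  have e1 := hmin 1 d1.symm
  have e2 := hmin 2 d2.symm
  have hsupp : ∀ s ∈ P.support, ∀ i, pderiv i P = 0 → s i = 0 := by
    intro s hs i hi
    by_contra hsi
    have h := coeff_pderiv (i := i) P (s - Finsupp.single i 1)
    have hle : Finsupp.single i 1 ≤ s := by
      rw [Finsupp.single_le_iff]; omega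
    rw [hi, coeff_zero, tsub_add_cancel_of_le hle] at h
    rcases mul_eq_zero.1 h.symm with h' | h'
    · exact MvPolynomial.mem_support_iff.1 hs h'
    · exact absurd h' (by positivity)
  have hvars : (P.vars : Set (Fin 3)) ⊆ Set.range fun _ : Unit => (0 : Fin 3) := by
    intro i hi
    rw [Finset.mem_coe, mem_vars_iff_mem_support] at hi
    obtain ⟨s, hs, hsi⟩ := hi
    rw [Finsupp.mem_support_iff] at hsi
    fin_cases i
    · exact ⟨(), rfl⟩
    · exact absurd (hsupp s hs 1 e1) hsi
    · exact absurd (hsupp s hs 2 e2) hsi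
  obtain ⟨Q, rfl⟩ := exists_rename_eq_of_vars_subset_range P (fun _ : Unit => (0 : Fin 3))
    (Function.injective_of_subsingleton _) hvars
  by_contra hna
  have hind : AlgebraicIndependent ℚ fun _ : Unit => a :=
    (algebraicIndependent_unique_type_iff (x := fun _ : Unit => a)).2 hna
  rw [aeval_rename] at hP
  have hQ : Q = 0 := algebraicIndependent_iff.1 hind Q (by
    rw [← hP]; rfl)
  exact hP0 (by rw [hQ, map_zero])

/-- Tangent vectors of `m = 0` extend to derivations of its function field. -/
theorem exists_derivation {A : Type*} [CommRing A] [IsDomain A] [Algebra ℚ A] [Algebra A K]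
    [IsScalarTower ℚ A K] [IsFractionRing A K] {m : MvPolynomial (Fin 3) ℚ} {y : Fin 3 → A}
    (hsurj : Function.Surjective (aeval y : MvPolynomial (Fin 3) ℚ →ₐ[ℚ] A))
    (hm0 : aeval y m = 0) (hdvd : ∀ F : MvPolynomial (Fin 3) ℚ, aeval y F = 0 → m ∣ F)
    (d : Fin 3 → K)
    (hd : ∑ i, aeval (fun i => algebraMap A K (y i)) (pderiv i m) * d i = 0) :
    ∃ D : Derivation ℚ K K, ∀ i, D (algebraMap A K (y i)) = d i := by
  classical
  set ξ : Fin 3 → K := fun i => algebraMap A K (y i) with hξ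
  have hyξ : ∀ F : MvPolynomial (Fin 3) ℚ, aeval ξ F = algebraMap A K (aeval y F) := fun F =>
    aeval_algebraMap_apply K y F
  -- A derivation is a homomorphism to the dual numbers, here `F ↦ F(ξ + ε d)`. Tangency of `d`
  -- makes it kill `m`, hence descend to `A`. It extends to `K` because a dual number with nonzero
  -- first component is a unit.
  let g : MvPolynomial (Fin 3) ℚ →ₐ[ℚ] TrivSqZeroExt K K :=
    aeval fun i => TrivSqZeroExt.inl (ξ i) + TrivSqZeroExt.inr (d i)
  have hg1 : ∀ F, (g F).fst = aeval ξ F := by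
    intro F
    have : (TrivSqZeroExt.fstHom ℚ K K).comp g = aeval ξ := by
      apply algHom_ext
      intro i
      simp [g]
    exact DFunLike.congr_fun this F
  have hg2 : ∀ F, (g F).snd = ∑ i, aeval ξ (pderiv i F) * d i := by
    intro F
    induction F using MvPolynomial.induction_on with
    | C a =>
      rw [← algebraMap_eq, AlgHom.commutes, TrivSqZeroExt.algebraMap_eq_inl']
      simp
    | add p q hp hq => simp [hp, hq, add_mul, Finset.sum_add_distrib]
    | mul_X p i hp =>
      have h1 : (g (X i)).snd = d i := by simp [g]
      have h2 : (g (X i)).fst = ξ i := by simp [g]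
      rw [map_mul, TrivSqZeroExt.snd_mul, hp, hg1, h1, h2]
      simp only [map_mul, aeval_X, Derivation.leibniz, smul_eq_mul, map_add, pderiv_X, add_mul,
        Finset.sum_add_distrib, MulOpposite.smul_eq_mul_unop, MulOpposite.unop_op]
      congr 1
      · simp [Pi.single_apply]
      · rw [Finset.sum_mul]
        exact Finset.sum_congr rfl fun j _ => by ring
  have hker : RingHom.ker (aeval y : MvPolynomial (Fin 3) ℚ →ₐ[ℚ] A) ≤ RingHom.ker g := by
    intro F hF
    rw [RingHom.mem_ker] at hF ⊢
    obtain ⟨G, rfl⟩ := hdvd F hF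
    have hgm : g m = 0 := by
      ext
      · rw [hg1, hyξ, hm0, map_zero]; rfl
      · rw [hg2, hd]; rfl
    rw [map_mul, hgm, zero_mul]
  let ψ : A →ₐ[ℚ] TrivSqZeroExt K K := AlgHom.liftOfSurjective _ hsurj g hker
  have hψ : ∀ F, ψ (aeval y F) = g F := fun F => AlgHom.liftOfSurjective_apply _ hsurj g hker F
  have hψ1 : ∀ a, (ψ a).fst = algebraMap A K a := by
    intro a
    obtain ⟨F, rfl⟩ := hsurj a
    rw [hψ, hg1, hyξ]
  have hunit : ∀ s : nonZeroDivisors A, IsUnit (ψ s) := by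
    intro s
    rw [TrivSqZeroExt.isUnit_iff_isUnit_fst, hψ1, isUnit_iff_ne_zero]
    exact IsFractionRing.to_map_ne_zero_of_mem_nonZeroDivisors s.2
  let Ψ : K →ₐ[ℚ] TrivSqZeroExt K K := IsLocalization.liftAlgHom (M := nonZeroDivisors A) hunit
  have hΨ : ∀ a, Ψ (algebraMap A K a) = ψ a := fun a => IsLocalization.lift_eq _ a
  have hΨ1 : ∀ a, (Ψ a).fst = a := by
    have : (TrivSqZeroExt.fstHom ℚ K K).comp Ψ = AlgHom.id ℚ K := by
      apply AlgHom.coe_ringHom_injective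
      refine IsLocalization.ringHom_ext (nonZeroDivisors A) ?_
      ext a
      change (Ψ (algebraMap A K a)).fst = algebraMap A K a
      rw [hΨ, hψ1]
    exact fun a => DFunLike.congr_fun this a
  refine ⟨Derivation.mk' ((TrivSqZeroExt.sndHom K K).restrictScalars ℚ ∘ₗ Ψ.toLinearMap) ?_, ?_⟩
  · intro a b
    simp [TrivSqZeroExt.snd_mul, hΨ1, mul_comm b]
  · intro i
    have h1 : Ψ (ξ i) = g (X i) := by
      rw [hξ, hΨ, ← hψ, aeval_X]
    have h2 : (Ψ (ξ i)).snd = d i := by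
      rw [h1]; simp [g]
    exact h2

end DerivationField

end SurfaceFramework

/-! ### Totally umbilic graphs -/

namespace SurfaceFramework

open MvPolynomial Module

section UmbilicField

variable {K : Type*} [Field K] [Algebra ℚ K]

/-- The Codazzi equations of a totally umbilic graph. -/
theorem derivation_curvature {D₁ D₂ : Derivation ℚ K K} (hcomm : ∀ a, D₁ (D₂ a) = D₂ (D₁ a))
    {ν μ l : K} (hs : 1 + ν ^ 2 + μ ^ 2 ≠ 0)
    (h1ν : D₁ ν = l * (1 + ν ^ 2)) (h1μ : D₁ μ = l * (ν * μ)) (h2ν : D₂ ν = l * (ν * μ))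
    (h2μ : D₂ μ = l * (1 + μ ^ 2)) : D₁ l = l ^ 2 * ν ∧ D₂ l = l ^ 2 * μ := by
  -- Equality of mixed derivatives of the slopes gives two linear equations for `D₁ l` and `D₂ l`,
  -- with determinant 1 + ν² + μ².
  have c1 := hcomm ν
  have c2 := hcomm μ
  rw [h1ν, h2ν] at c1
  rw [h1μ, h2μ] at c2
  simp only [Derivation.leibniz, Derivation.leibniz_pow, map_add, Derivation.map_one_eq_zero,
    smul_eq_mul, h1ν, h1μ, h2ν, h2μ, nsmul_eq_mul, Nat.cast_ofNat, Nat.add_one_sub_one,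
    pow_one] at c1 c2
  constructor
  · apply mul_left_cancel₀ hs
    linear_combination (-(ν * μ)) * c1 + (1 + ν ^ 2) * c2
  · apply mul_left_cancel₀ hs
    linear_combination (-(1 + μ ^ 2)) * c1 + (ν * μ) * c2

/-- The centre of a totally umbilic graph that is not flat is constant. -/
theorem derivation_center {D₁ D₂ : Derivation ℚ K K} (hcomm : ∀ a, D₁ (D₂ a) = D₂ (D₁ a))
    {ν μ l x y z : K} (hs : 1 + ν ^ 2 + μ ^ 2 ≠ 0) (hl : l ≠ 0)
    (h1ν : D₁ ν = l * (1 + ν ^ 2)) (h1μ : D₁ μ = l * (ν * μ)) (h2ν : D₂ ν = l * (ν * μ))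
    (h2μ : D₂ μ = l * (1 + μ ^ 2)) (h1x : D₁ x = 1) (h1y : D₁ y = 0) (h1z : D₁ z = ν)
    (h2x : D₂ x = 0) (h2y : D₂ y = 1) (h2z : D₂ z = μ) :
    (D₁ (x - ν / l) = 0 ∧ D₂ (x - ν / l) = 0) ∧ (D₁ (y - μ / l) = 0 ∧ D₂ (y - μ / l) = 0) ∧
      (D₁ (z + 1 / l) = 0 ∧ D₂ (z + 1 / l) = 0) := by
  obtain ⟨h1l, h2l⟩ := derivation_curvature hcomm hs h1ν h1μ h2ν h2μ
  refine ⟨⟨?_, ?_⟩, ⟨?_, ?_⟩, ?_, ?_⟩ <;>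
    simp only [map_add, map_sub, Derivation.leibniz_div, Derivation.map_one_eq_zero, smul_eq_mul,
      h1ν, h1μ, h2ν, h2μ, h1x, h1y, h1z, h2x, h2y, h2z, h1l, h2l] <;>
    field_simp <;> ring

end UmbilicField

section UmbilicPoint

theorem sum_rotate {R : Type*} [AddCommMonoid R] (j : Fin 3) (f : Fin 3 → R) :
    ∑ i, f i = f j + f (j + 1) + f (j + 2) := by
  rw [Fin.sum_univ_three]
  fin_cases j
  · rfl
  · change f 0 + f 1 + f 2 = f 1 + f 2 + f 0
    abel
  · change f 0 + f 1 + f 2 = f 2 + f 0 + f 1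
    abel

/-- The tangent vector with coordinates `a`, `b` at `j + 1`, `j + 2` has coordinate νa + μb at `j`.
Its umbilic form is `n j` times the left side. Cyclic indexing preserves orientation, so the sign is
the same for every `j`. -/
theorem umbilic_form (j : Fin 3) {n : Fin 3 → ℝ} {H : Matrix (Fin 3) (Fin 3) ℝ}
    (hH : ∀ a b, H a b = H b a) {ν μ : ℝ} (hν : n (j + 1) = -ν * n j) (hμ : n (j + 2) = -μ * n j)
    (hj : n j ≠ 0) (humb : ∀ e, e ⬝ᵥ n = 0 → e ⬝ᵥ (H *ᵥ (n ⨯₃ e)) = 0) (a b : ℝ) :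
    a ^ 2 * (-(μ * ν) * (H (j + 1) (j + 1) + 2 * ν * H (j + 1) j + ν ^ 2 * H j j)
      + (1 + ν ^ 2) * (H (j + 1) (j + 2) + ν * H (j + 2) j + μ * H (j + 1) j + μ * ν * H j j))
    + a * b * (-(1 + μ ^ 2) * (H (j + 1) (j + 1) + 2 * ν * H (j + 1) j + ν ^ 2 * H j j)
      + (1 + ν ^ 2) * (H (j + 2) (j + 2) + 2 * μ * H (j + 2) j + μ ^ 2 * H j j))
    + b ^ 2 * (-(1 + μ ^ 2) *
        (H (j + 1) (j + 2) + ν * H (j + 2) j + μ * H (j + 1) j + μ * ν * H j j)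
      + μ * ν * (H (j + 2) (j + 2) + 2 * μ * H (j + 2) j + μ ^ 2 * H j j)) = 0 := by
  apply mul_left_cancel₀ hj
  rw [mul_zero]
  fin_cases j
  · simp only [Fin.zero_eta, Fin.isValue, zero_add] at *
    have h := humb ![ν * a + μ * b, a, b] (by
      simp [dotProduct, Fin.sum_univ_three, hν, hμ]; ring)
    simp [dotProduct, Matrix.mulVec, Fin.sum_univ_three, cross_apply, hν, hμ, hH 0 1, hH 0 2,
      hH 1 2] at h
    rw [← h]
    simp only [hH 1 2]
    ring
  · simp only [Fin.mk_one, Fin.isValue, Fin.reduceAdd] at *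
    have h := humb ![b, ν * a + μ * b, a] (by
      simp [dotProduct, Fin.sum_univ_three, hν, hμ]; ring)
    simp [dotProduct, Matrix.mulVec, Fin.sum_univ_three, cross_apply, hν, hμ, hH 0 1, hH 0 2,
      hH 1 2] at h
    rw [← h]
    simp only [hH 0 1]
    ring
  · simp only [Fin.reduceFinMk, Fin.isValue, Fin.reduceAdd] at *
    have h := humb ![a, b, ν * a + μ * b] (by
      simp [dotProduct, Fin.sum_univ_three, hν, hμ]; ring)
    simp [dotProduct, Matrix.mulVec, Fin.sum_univ_three, cross_apply, hν, hμ, hH 0 1, hH 0 2,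
      hH 1 2] at h
    rw [← h]
    simp only [hH 0 1, hH 0 2, hH 1 2]
    ring

end UmbilicPoint

end SurfaceFramework

/-! ### Algebraicity of the normal direction or the centre of curvature -/

namespace SurfaceFramework

open MvPolynomial Module

section Constants

/-- The numerator of the curvature of the surface at an umbilic point. -/
noncomputable def curvatureNum (m : MvPolynomial (Fin 3) ℚ) (j : Fin 3) :
    MvPolynomial (Fin 3) ℚ :=
  (pderiv (j + 1) (pderiv (j + 1) m) * pderiv j m ^ 2
    - 2 * pderiv j m * pderiv (j + 1) m * pderiv (j + 1) (pderiv j m)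
    + pderiv (j + 1) m ^ 2 * pderiv j (pderiv j m)) +
  (pderiv (j + 2) (pderiv (j + 2) m) * pderiv j m ^ 2
    - 2 * pderiv j m * pderiv (j + 2) m * pderiv (j + 2) (pderiv j m)
    + pderiv (j + 2) m ^ 2 * pderiv j (pderiv j m))

/-- The denominator of the curvature of the surface at an umbilic point. -/
noncomputable def curvatureDen (m : MvPolynomial (Fin 3) ℚ) (j : Fin 3) :
    MvPolynomial (Fin 3) ℚ :=
  2 * pderiv j m ^ 2 + pderiv (j + 1) m ^ 2 + pderiv (j + 2) m ^ 2

theorem derivation_eq_zero {A K : Type*} [CommRing A] [IsDomain A] [Algebra ℚ A] [Field K]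
    [Algebra ℚ K] [Algebra A K] [IsScalarTower ℚ A K] [IsFractionRing A K] {y : Fin 3 → A}
    (hsurj : Function.Surjective (aeval y : MvPolynomial (Fin 3) ℚ →ₐ[ℚ] A))
    (D : Derivation ℚ K K) (hD : ∀ i, D (algebraMap A K (y i)) = 0) (a : K) : D a = 0 := by
  have hA : ∀ a : A, D (algebraMap A K a) = 0 := by
    intro a
    obtain ⟨F, rfl⟩ := hsurj a
    rw [← aeval_algebraMap_apply, derivation_aeval]
    simp [hD]
  obtain ⟨r, s, _, rfl⟩ := IsFractionRing.div_surjective (A := A) a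
  rw [Derivation.leibniz_div, hA, hA]
  simp

theorem isAlgebraic_adjoin_range {A K : Type*} [CommRing A] [IsDomain A] [Algebra ℚ A] [Field K]
    [Algebra ℚ K] [Algebra A K] [IsScalarTower ℚ A K] [IsFractionRing A K] {y : Fin 3 → A}
    (hsurj : Function.Surjective (aeval y : MvPolynomial (Fin 3) ℚ →ₐ[ℚ] A)) :
    Algebra.IsAlgebraic
      (Algebra.adjoin ℚ (Set.range fun i => algebraMap A K (y i))) K := by
  constructor
  intro a
  have hA : ∀ a : A, IsAlgebraic (Algebra.adjoin ℚ (Set.range fun i => algebraMap A K (y i)))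
      (algebraMap A K a) := by
    intro a
    obtain ⟨F, rfl⟩ := hsurj a
    rw [← aeval_algebraMap_apply]
    have hmem : aeval (fun i => algebraMap A K (y i)) F ∈
        Algebra.adjoin ℚ (Set.range fun i => algebraMap A K (y i)) := by
      rw [Algebra.adjoin_range_eq_range_aeval]
      exact ⟨F, rfl⟩
    exact isAlgebraic_algebraMap
      (⟨_, hmem⟩ : Algebra.adjoin ℚ (Set.range fun i => algebraMap A K (y i)))
  obtain ⟨r, s, _, rfl⟩ := IsFractionRing.div_surjective (A := A) a
  rw [div_eq_mul_inv]
  exact (hA r).mul (hA s).inv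

theorem center_coordinate {K : Type*} [Field K] {x ν l a s : K} (ha : a ≠ 0) (hl : l ≠ 0)
    (hs : s ≠ 0) : x - -ν * a * (a ^ 2 * s) / (-l * a ^ 3 * s) = x - ν / l := by
  field_simp

theorem center_height {K : Type*} [Field K] {z l a s : K} (ha : a ≠ 0) (hl : l ≠ 0)
    (hs : s ≠ 0) : z - a * (a ^ 2 * s) / (-l * a ^ 3 * s) = z + 1 / l := by
  field_simp
  ring

set_option maxHeartbeats 800000 in
/-- At a generic umbilic point either the normal direction or the centre of curvature is
algebraic, in a model of the function field. -/
theorem isAlgebraic_of_umbilic_aux {A K : Type*} [CommRing A] [IsDomain A] [Algebra ℚ A] [Field K]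
    [Algebra ℚ K] [Algebra A K] [IsScalarTower ℚ A K] [IsFractionRing A K] {y : Fin 3 → A}
    {m : MvPolynomial (Fin 3) ℚ}
    (hsurj : Function.Surjective (aeval y : MvPolynomial (Fin 3) ℚ →ₐ[ℚ] A))
    (hm0 : aeval y m = 0) (hdvd : ∀ F : MvPolynomial (Fin 3) ℚ, aeval y F = 0 → m ∣ F)
    (hm : m ≠ 0) (ι : K →ₐ[ℚ] ℝ) {x : Fin 3 → ℝ} (hι : ∀ i, ι (algebraMap A K (y i)) = x i)
    {j : Fin 3} (hj : normal m x j ≠ 0)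
    (humb : ∀ e, e ⬝ᵥ normal m x = 0 → e ⬝ᵥ (hessian m x *ᵥ (normal m x ⨯₃ e)) = 0) :
    (aeval x (curvatureNum m j) = 0 → ∀ i, IsAlgebraic ℚ (normal m x i / normal m x j)) ∧
    (aeval x (curvatureNum m j) ≠ 0 → ∀ i, IsAlgebraic ℚ
      (x i - normal m x i * aeval x (curvatureDen m j) / aeval x (curvatureNum m j))) := by
  set ξ : Fin 3 → K := fun i => algebraMap A K (y i) with hξ
  have hιF : ∀ F : MvPolynomial (Fin 3) ℚ, ι (aeval ξ F) = aeval x F := by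
    intro F
    have : ι.comp (aeval ξ) = aeval x := by
      apply algHom_ext
      intro i
      simp [hι, hξ]
    exact DFunLike.congr_fun this F
  have hinj : Function.Injective ι := ι.toRingHom.injective
  set N : Fin 3 → K := fun i => aeval ξ (pderiv i m) with hN
  set h : Fin 3 → Fin 3 → K := fun a b => aeval ξ (pderiv a (pderiv b m)) with hh
  have hιN : ∀ i, ι (N i) = normal m x i := fun i => hιF _
  have hιh : ∀ a b, ι (h a b) = hessian m x a b := fun a b => hιF _
  have hsymm : ∀ a b, h a b = h b a := fun a b => hinj (by
    rw [hιh, hιh, hessian_symm])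
  have hNj : N j ≠ 0 := fun h0 => hj (by rw [← hιN, h0, map_zero])
  set ν : K := -N (j + 1) / N j with hν
  set μ : K := -N (j + 2) / N j with hμ
  have hν' : N (j + 1) = -ν * N j := by rw [hν]; field_simp
  have hμ' : N (j + 2) = -μ * N j := by rw [hμ]; field_simp
  have hj1 : j + 1 ≠ j := by fin_cases j <;> decide
  have hj2 : j + 2 ≠ j := by fin_cases j <;> decide
  have hj3 : j + 2 ≠ j + 1 := by fin_cases j <;> decide
  have hdep : ¬ AlgebraicIndependent ℚ ξ := by
    intro hind
    refine hm (algebraicIndependent_iff.1 hind m ?_)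
    have := aeval_algebraMap_apply (R := ℚ) K y m
    rw [hm0, map_zero] at this
    exact this
  have hgen : Algebra.IsAlgebraic (Algebra.adjoin ℚ (Set.range ξ)) K :=
    isAlgebraic_adjoin_range hsurj
  -- The two coordinate derivations.
  obtain ⟨D₁, hD₁⟩ := exists_derivation (K := K) hsurj hm0 hdvd
    (fun i => if i = j then ν else if i = j + 1 then 1 else 0) (by
      rw [sum_rotate j]
      change N j * _ + N (j + 1) * _ + N (j + 2) * _ = 0
      simp only [if_true, if_neg hj1, if_neg hj2, if_neg hj3, hν']
      ring)
  obtain ⟨D₂, hD₂⟩ := exists_derivation (K := K) hsurj hm0 hdvd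
    (fun i => if i = j then μ else if i = j + 2 then 1 else 0) (by
      rw [sum_rotate j]
      change N j * _ + N (j + 1) * _ + N (j + 2) * _ = 0
      simp only [if_true, if_neg hj1, if_neg hj2, if_neg hj3.symm, hμ']
      ring)
  have h1x : D₁ (ξ (j + 1)) = 1 := by rw [hD₁, if_neg hj1, if_pos rfl]
  have h1y : D₁ (ξ (j + 2)) = 0 := by rw [hD₁, if_neg hj2, if_neg hj3]
  have h1z : D₁ (ξ j) = ν := by rw [hD₁, if_pos rfl]
  have h2x : D₂ (ξ (j + 1)) = 0 := by rw [hD₂, if_neg hj1, if_neg hj3.symm]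
  have h2y : D₂ (ξ (j + 2)) = 1 := by rw [hD₂, if_neg hj2, if_pos rfl]
  have h2z : D₂ (ξ j) = μ := by rw [hD₂, if_pos rfl]
  have h1N : ∀ i, D₁ (N i) = h j i * ν + h (j + 1) i := by
    intro i
    rw [hN, derivation_aeval, sum_rotate j, h1x, h1y, h1z]
    simp [hh]
  have h2N : ∀ i, D₂ (N i) = h j i * μ + h (j + 2) i := by
    intro i
    rw [hN, derivation_aeval, sum_rotate j, h2x, h2y, h2z]
    simp [hh]
  -- The `a`'s are -N j times the second derivatives of the coordinate `j`, viewed as a function of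
  -- the other two.
  set a11 := h (j + 1) (j + 1) + 2 * ν * h (j + 1) j + ν ^ 2 * h j j with ha11
  set a12 := h (j + 1) (j + 2) + ν * h (j + 2) j + μ * h (j + 1) j + μ * ν * h j j with ha12
  set a22 := h (j + 2) (j + 2) + 2 * μ * h (j + 2) j + μ ^ 2 * h j j with ha22
  have e1ν : D₁ ν = -a11 / N j := by
    conv_lhs => rw [hν]
    rw [Derivation.leibniz_div, map_neg, h1N, h1N, hν', ha11, hsymm j (j + 1)]
    simp only [smul_eq_mul]
    field_simp
    ring
  have e1μ : D₁ μ = -a12 / N j := by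
    conv_lhs => rw [hμ]
    rw [Derivation.leibniz_div, map_neg, h1N, h1N, hμ', ha12, hsymm j (j + 2)]
    simp only [smul_eq_mul]
    field_simp
    ring
  have e2ν : D₂ ν = -a12 / N j := by
    conv_lhs => rw [hν]
    rw [Derivation.leibniz_div, map_neg, h2N, h2N, hν', ha12, hsymm j (j + 1),
      hsymm (j + 2) (j + 1)]
    simp only [smul_eq_mul]
    field_simp
    ring
  have e2μ : D₂ μ = -a22 / N j := by
    conv_lhs => rw [hμ]
    rw [Derivation.leibniz_div, map_neg, h2N, h2N, hμ', ha22, hsymm j (j + 2)]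
    simp only [smul_eq_mul]
    field_simp
    ring
  -- The umbilic equations.
  have hform := umbilic_form j (hessian_symm m x) (ν := ι ν) (μ := ι μ)
    (by rw [← hιN, ← hιN, hν', map_mul, map_neg]) (by rw [← hιN, ← hιN, hμ', map_mul, map_neg])
    hj humb
  simp only [← hιh] at hform
  have f1 := hform 1 0
  have f2 := hform 0 1
  have f3 := hform 1 1
  have g1 : -(μ * ν) * a11 + (1 + ν ^ 2) * a12 = 0 := hinj (by
    simp only [ha11, ha12, map_add, map_mul, map_neg, map_pow, map_one, map_zero, map_ofNat]
    linear_combination f1)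
  have g3 : -(1 + μ ^ 2) * a11 + (1 + ν ^ 2) * a22 = 0 := hinj (by
    simp only [ha11, ha22, map_add, map_mul, map_neg, map_pow, map_one, map_zero, map_ofNat]
    linear_combination f3 - f1 - f2)
  -- Since `K` embeds in ℝ, these sums of squares do not vanish.
  have hpos1 : 1 + ν ^ 2 ≠ 0 := fun h0 => by
    have := congrArg ι h0
    simp only [map_add, map_pow, map_one, map_zero] at this
    nlinarith [sq_nonneg (ι ν)]
  have hpos2 : 1 + ν ^ 2 + μ ^ 2 ≠ 0 := fun h0 => by
    have := congrArg ι h0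
    simp only [map_add, map_pow, map_one, map_zero] at this
    nlinarith [sq_nonneg (ι ν), sq_nonneg (ι μ)]
  have hpos3 : 2 + ν ^ 2 + μ ^ 2 ≠ 0 := fun h0 => by
    have := congrArg ι h0
    simp only [map_add, map_pow, map_ofNat, map_zero] at this
    nlinarith [sq_nonneg (ι ν), sq_nonneg (ι μ)]
  -- Umbilicity makes the second derivatives of the graph equal to `l` times the first fundamental
  -- form 1 + ν², νμ, 1 + μ².
  set l : K := -a11 / (N j * (1 + ν ^ 2)) with hl
  have ka11 : a11 = -l * N j * (1 + ν ^ 2) := by rw [hl]; field_simp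
  have ka12 : a12 = -l * N j * (ν * μ) := by
    apply mul_left_cancel₀ hpos1
    linear_combination g1 + (μ * ν) * ka11
  have ka22 : a22 = -l * N j * (1 + μ ^ 2) := by
    apply mul_left_cancel₀ hpos1
    linear_combination g3 + (1 + μ ^ 2) * ka11
  have k1ν : D₁ ν = l * (1 + ν ^ 2) := by rw [e1ν, ka11]; field_simp
  have k1μ : D₁ μ = l * (ν * μ) := by rw [e1μ, ka12]; field_simp
  have k2ν : D₂ ν = l * (ν * μ) := by rw [e2ν, ka12]; field_simp
  have k2μ : D₂ μ = l * (1 + μ ^ 2) := by rw [e2μ, ka22]; field_simp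
  have hcomm : ∀ a, D₁ (D₂ a) = D₂ (D₁ a) := by
    intro a
    have : (⁅D₁, D₂⁆ : Derivation ℚ K K) a = 0 := by
      refine derivation_eq_zero hsurj _ (fun i => ?_) a
      rw [Derivation.commutator_apply, sub_eq_zero]
      change D₁ (D₂ (ξ i)) = D₂ (D₁ (ξ i))
      have : i = j ∨ i = j + 1 ∨ i = j + 2 := by
        fin_cases j <;> fin_cases i <;> decide
      rcases this with rfl | rfl | rfl
      · rw [h1z, h2z, k1μ, k2ν]
      · rw [h1x, h2x]; simp
      · rw [h1y, h2y]; simp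
    rwa [Derivation.commutator_apply, sub_eq_zero] at this
  have halg : ∀ a, D₁ a = 0 → D₂ a = 0 → IsAlgebraic ℚ (ι a) := fun a h1 h2 =>
    (isAlgebraic_of_derivation_eq_zero hgen hdep h1x h1y h2x h2y h1 h2).algHom ι
  have hcases : ∀ i, i = j ∨ i = j + 1 ∨ i = j + 2 := by
    intro i; fin_cases j <;> fin_cases i <;> decide
  -- The trace `a11 + a22` is used so that the matching denominator is a sum of squares of the
  -- gradient, nonzero at every regular real point.
  have hnum : aeval ξ (curvatureNum m j) = -l * N j ^ 3 * (2 + ν ^ 2 + μ ^ 2) := by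
    have : aeval ξ (curvatureNum m j) = N j ^ 2 * (a11 + a22) := by
      simp only [curvatureNum, map_add, map_sub, map_mul, map_pow, map_ofNat]
      change (h (j + 1) (j + 1) * N j ^ 2 - 2 * N j * N (j + 1) * h (j + 1) j
        + N (j + 1) ^ 2 * h j j) + (h (j + 2) (j + 2) * N j ^ 2
        - 2 * N j * N (j + 2) * h (j + 2) j + N (j + 2) ^ 2 * h j j) = _
      rw [hν', hμ', ha11, ha22]
      ring
    rw [this, ka11, ka22]
    ring
  have hden : aeval ξ (curvatureDen m j) = N j ^ 2 * (2 + ν ^ 2 + μ ^ 2) := by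
    simp only [curvatureDen, map_add, map_mul, map_pow, map_ofNat]
    change 2 * N j ^ 2 + N (j + 1) ^ 2 + N (j + 2) ^ 2 = _
    rw [hν', hμ']
    ring
  have hnum0 : aeval x (curvatureNum m j) = 0 ↔ l = 0 := by
    rw [← hιF, map_eq_zero_iff ι hinj, hnum]
    simp [hNj, hpos3]
  constructor
  · intro h0 i
    have hl0 : l = 0 := hnum0.1 h0
    have key : IsAlgebraic ℚ (ι (N i / N j)) := by
      rcases hcases i with rfl | rfl | rfl
      · rw [div_self hNj, map_one]; exact isAlgebraic_one
      · apply halg <;> rw [hν', mul_div_assoc, div_self hNj, mul_one, map_neg]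
        · rw [k1ν, hl0]; simp
        · rw [k2ν, hl0]; simp
      · apply halg <;> rw [hμ', mul_div_assoc, div_self hNj, mul_one, map_neg]
        · rw [k1μ, hl0]; simp
        · rw [k2μ, hl0]; simp
    rwa [map_div₀, hιN, hιN] at key
  · intro h0 i
    have hl0 : l ≠ 0 := fun h => h0 (hnum0.2 h)
    obtain ⟨⟨c1, c2⟩, ⟨c3, c4⟩, c5, c6⟩ := derivation_center hcomm hpos2 hl0 k1ν k1μ k2ν k2μ
      h1x h1y h1z h2x h2y h2z
    have key : IsAlgebraic ℚ (ι (ξ i -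
        N i * aeval ξ (curvatureDen m j) / aeval ξ (curvatureNum m j))) := by
      rw [hnum, hden]
      rcases hcases i with rfl | rfl | rfl
      · rw [center_height hNj hl0 hpos3]; exact halg _ c5 c6
      · rw [hν', center_coordinate hNj hl0 hpos3]; exact halg _ c1 c2
      · rw [hμ', center_coordinate hNj hl0 hpos3]; exact halg _ c3 c4
    rwa [map_sub, map_div₀, map_mul, hιN, hιF, hιF, show ι (ξ i) = x i from hι i] at key

theorem isAlgebraic_of_umbilic_of_embedding {A : Type*} [CommRing A] [IsDomain A] [Algebra ℚ A]
    {g : A →ₐ[ℚ] ℝ} (hg : Function.Injective g) {y : Fin 3 → A}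
    (hsurj : Function.Surjective (aeval y : MvPolynomial (Fin 3) ℚ →ₐ[ℚ] A))
    {m : MvPolynomial (Fin 3) ℚ} {x : Fin 3 → ℝ} (hy : ∀ i, g (y i) = x i)
    (hm : m ≠ 0) (hm0 : aeval x m = 0)
    (hdvd : ∀ F : MvPolynomial (Fin 3) ℚ, aeval x F = 0 → m ∣ F)
    {j : Fin 3} (hj : normal m x j ≠ 0)
    (humb : ∀ e, e ⬝ᵥ normal m x = 0 → e ⬝ᵥ (hessian m x *ᵥ (normal m x ⨯₃ e)) = 0) :
    (aeval x (curvatureNum m j) = 0 → ∀ i, IsAlgebraic ℚ (normal m x i / normal m x j)) ∧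
    (aeval x (curvatureNum m j) ≠ 0 → ∀ i, IsAlgebraic ℚ
      (x i - normal m x i * aeval x (curvatureDen m j) / aeval x (curvatureNum m j))) := by
  have hgy : ∀ F : MvPolynomial (Fin 3) ℚ, g (aeval y F) = aeval x F := by
    intro F
    have : g.comp (aeval y) = aeval x := by
      apply algHom_ext
      intro i
      simp [hy]
    exact DFunLike.congr_fun this F
  have hy0 : ∀ F : MvPolynomial (Fin 3) ℚ, aeval y F = 0 ↔ aeval x F = 0 := fun F => by
    rw [← hgy, map_eq_zero_iff g hg]
  refine isAlgebraic_of_umbilic_aux (K := FractionRing A) hsurj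
    ((hy0 m).2 hm0) (fun F hF => hdvd F ((hy0 F).1 hF)) hm
    (IsFractionRing.liftAlgHom (g := g) hg) (fun i => ?_) hj humb
  rw [← hy i]
  exact IsFractionRing.lift_algebraMap (g := g.toRingHom) hg (y i)

theorem surjective_aeval_rangeRestrict {σ B : Type*} [CommRing B] [Algebra ℚ B]
    (φ : MvPolynomial σ ℚ →ₐ[ℚ] B) :
    Function.Surjective
      (aeval (fun i => φ.rangeRestrict (X i)) : MvPolynomial σ ℚ →ₐ[ℚ] φ.range) := by
  intro b
  obtain ⟨F, rfl⟩ := φ.rangeRestrict_surjective b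
  exact ⟨F, (DFunLike.congr_fun (aeval_unique φ.rangeRestrict) F).symm⟩

/-- At a generic umbilic point either the normal direction or the centre of curvature is
algebraic. -/
theorem isAlgebraic_of_umbilic {m : MvPolynomial (Fin 3) ℚ} {x : Fin 3 → ℝ}
    (hm : m ≠ 0) (hm0 : aeval x m = 0)
    (hdvd : ∀ F : MvPolynomial (Fin 3) ℚ, aeval x F = 0 → m ∣ F)
    {j : Fin 3} (hj : normal m x j ≠ 0)
    (humb : ∀ e, e ⬝ᵥ normal m x = 0 → e ⬝ᵥ (hessian m x *ᵥ (normal m x ⨯₃ e)) = 0) :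
    (aeval x (curvatureNum m j) = 0 → ∀ i, IsAlgebraic ℚ (normal m x i / normal m x j)) ∧
    (aeval x (curvatureNum m j) ≠ 0 → ∀ i, IsAlgebraic ℚ
      (x i - normal m x i * aeval x (curvatureDen m j) / aeval x (curvatureNum m j))) := by
  exact isAlgebraic_of_umbilic_of_embedding
    (g := (aeval x : MvPolynomial (Fin 3) ℚ →ₐ[ℚ] ℝ).range.val) Subtype.val_injective
    (surjective_aeval_rangeRestrict _) (fun i => aeval_X _ _) hm hm0 hdvd hj humb

end Constants

end SurfaceFramework

/-! ### Generic pairs, constancy on the surface, and bounds on the type -/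

namespace SurfaceFramework

open MvPolynomial Module

section Pairs

variable {W : Type*} {m : MvPolynomial (Fin 3) ℚ} {M : Set (Fin 3 → ℝ)}

/-- Forgetting the vertex index sends every generator of the ideal to `m`. -/
theorem IsGeneric.dvd {p : W → Fin 3 → ℝ} (hp : IsGeneric m M p) (v : W)
    {F : MvPolynomial (Fin 3) ℚ} (hF : aeval (p v) F = 0) : m ∣ F := by
  have h1 := hp.2 (rename (fun i => (v, i)) F) (by rw [aeval_rename]; exact hF)
  have h2 := Ideal.mem_map_of_mem (rename (Prod.snd : W × Fin 3 → Fin 3) :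
    MvPolynomial (W × Fin 3) ℚ →ₐ[ℚ] MvPolynomial (Fin 3) ℚ) h1
  rw [Ideal.map_span, ← Set.range_comp, rename_rename] at h2
  rw [← Ideal.mem_span_singleton]
  have h3 : rename (Prod.snd ∘ fun i : Fin 3 => (v, i)) F = F := rename_id_apply F
  rw [h3] at h2
  refine Ideal.span_mono ?_ h2
  rintro _ ⟨u, rfl⟩
  simp only [Function.comp_apply, rename_rename, Set.mem_singleton_iff]
  exact rename_id_apply m

/-- The homogenization of a polynomial at a quotient of two polynomials. -/
theorem homogenized_eval (f : Polynomial ℚ) {a b : ℝ} (hb : b ≠ 0) :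
    ∑ i ∈ Finset.range (f.natDegree + 1), (f.coeff i : ℝ) * a ^ i * b ^ (f.natDegree - i) =
      b ^ f.natDegree * Polynomial.aeval (a / b) f := by
  rw [Polynomial.aeval_eq_sum_range, Finset.mul_sum]
  refine Finset.sum_congr rfl fun i hi => ?_
  have hi' : i ≤ f.natDegree := Nat.lt_succ_iff.1 (Finset.mem_range.1 hi)
  rw [Algebra.smul_def, div_pow, ← Nat.sub_add_cancel hi', pow_add, Nat.sub_add_cancel hi']
  rw [eq_ratCast]
  field_simp

/-- The divided difference of a polynomial. -/
noncomputable def dividedDifference (f : Polynomial ℚ) (a b : ℝ) : ℝ :=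
  ∑ i ∈ Finset.range (f.natDegree + 1), (f.coeff i : ℝ) *
    ∑ k ∈ Finset.range i, a ^ k * b ^ (i - 1 - k)

theorem dividedDifference_mul_sub (f : Polynomial ℚ) (a b : ℝ) :
    dividedDifference f a b * (a - b) = Polynomial.aeval a f - Polynomial.aeval b f := by
  rw [Polynomial.aeval_eq_sum_range, Polynomial.aeval_eq_sum_range, dividedDifference,
    Finset.sum_mul, ← Finset.sum_sub_distrib]
  refine Finset.sum_congr rfl fun i _ => ?_
  rw [mul_assoc, geom_sum₂_mul, Algebra.smul_def, Algebra.smul_def, eq_ratCast, mul_sub]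

theorem dividedDifference_self (f : Polynomial ℚ) (a : ℝ) :
    dividedDifference f a a = Polynomial.aeval a (Polynomial.derivative f) := by
  rw [Polynomial.derivative_apply, Polynomial.sum_over_range _ (by simp), map_sum,
    dividedDifference]
  refine Finset.sum_congr rfl fun i _ => ?_
  have h : ∀ k ∈ Finset.range i, a ^ k * a ^ (i - 1 - k) = a ^ (i - 1) := by
    intro k hk
    have := Finset.mem_range.1 hk
    rw [← pow_add]
    congr 1
    omega
  rw [Finset.sum_congr rfl h]
  simp [mul_assoc]

/-- Clearing the denominators turns the divided difference of two quotients into a polynomial over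
ℚ, to which genericity applies. -/
theorem homogenized_dividedDifference (f : Polynomial ℚ) {a b c d : ℝ} (hb : b ≠ 0) (hd : d ≠ 0) :
    ∑ i ∈ Finset.range (f.natDegree + 1), (f.coeff i : ℝ) * ∑ k ∈ Finset.range i,
      a ^ k * c ^ (i - 1 - k) * b ^ (f.natDegree - k) * d ^ (f.natDegree - (i - 1 - k)) =
      b ^ f.natDegree * d ^ f.natDegree * dividedDifference f (a / b) (c / d) := by
  rw [dividedDifference, Finset.mul_sum]
  refine Finset.sum_congr rfl fun i hi => ?_
  rw [mul_left_comm]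
  congr 1
  rw [Finset.mul_sum]
  refine Finset.sum_congr rfl fun k hk => ?_
  have hi' := Finset.mem_range.1 hi
  have hk' := Finset.mem_range.1 hk
  have h1 : b ^ f.natDegree = b ^ k * b ^ (f.natDegree - k) := by
    rw [← pow_add]; congr 1; omega
  have h2 : d ^ f.natDegree = d ^ (i - 1 - k) * d ^ (f.natDegree - (i - 1 - k)) := by
    rw [← pow_add]; congr 1; omega
  rw [h1, h2, div_pow, div_pow]
  field_simp

/-- A rational function with an algebraic value at the first point of a generic pair is constant
on the surface. -/
theorem mul_eq_mul_of_isAlgebraic (hM : ∀ x ∈ M, aeval x m = 0) {p : Fin 2 → Fin 3 → ℝ}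
    (hp : IsGeneric m M p) {A B : MvPolynomial (Fin 3) ℚ} (hB : aeval (p 0) B ≠ 0)
    (halg : IsAlgebraic ℚ (aeval (p 0) A / aeval (p 0) B)) {x y : Fin 3 → ℝ} (hx : x ∈ M)
    (hy : y ∈ M) : aeval x A * aeval y B = aeval y A * aeval x B := by
  let T : Fin 2 → MvPolynomial (Fin 3) ℚ →ₐ[ℚ] MvPolynomial (Fin 2 × Fin 3) ℚ :=
    fun v => rename fun i => (v, i)
  have hT : ∀ (q : Fin 2 → Fin 3 → ℝ) v F,
      aeval (fun c : Fin 2 × Fin 3 => q c.1 c.2) (T v F) = aeval (q v) F := by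
    intro q v F
    rw [aeval_rename]
    rfl
  have transfer : ∀ h : MvPolynomial (Fin 2 × Fin 3) ℚ,
      aeval (fun c : Fin 2 × Fin 3 => p c.1 c.2) h = 0 → ∀ x ∈ M, ∀ y ∈ M,
      aeval (fun c : Fin 2 × Fin 3 => (![x, y] : Fin 2 → Fin 3 → ℝ) c.1 c.2) h = 0 := by
    intro h h0 x hx y hy
    refine hp.aeval_eq_zero h0 ![x, y] fun v => ?_
    fin_cases v
    · exact hM x hx
    · exact hM y hy
  have hB1 : aeval (p 1) B ≠ 0 := by
    intro h0
    have := transfer (T 1 B) (by rw [hT, h0]) (p 0) (hp.1 0) (p 0) (hp.1 0)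
    rw [hT] at this
    exact hB this
  set f := minpoly ℚ (aeval (p 0) A / aeval (p 0) B) with hf
  have hfα : Polynomial.aeval (aeval (p 0) A / aeval (p 0) B) f = 0 := minpoly.aeval _ _
  have hfβ : Polynomial.aeval (aeval (p 1) A / aeval (p 1) B) f = 0 := by
    let F : MvPolynomial (Fin 3) ℚ := ∑ i ∈ Finset.range (f.natDegree + 1),
      C (f.coeff i) * A ^ i * B ^ (f.natDegree - i)
    have hF : ∀ z : Fin 3 → ℝ, aeval z B ≠ 0 → aeval z F =
        aeval z B ^ f.natDegree * Polynomial.aeval (aeval z A / aeval z B) f := by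
      intro z hz
      rw [← homogenized_eval f hz]
      simp [F]
    have h1 := transfer (T 0 F) (by rw [hT, hF _ hB, hfα, mul_zero]) (p 1) (hp.1 1) (p 1) (hp.1 1)
    rw [hT] at h1
    have h2 := hF (p 1) hB1
    rw [show aeval (p 1) F = 0 from h1] at h2
    exact (mul_eq_zero.1 h2.symm).resolve_left (pow_ne_zero _ hB1)
  -- One generic point only determines the value up to conjugation. If the values at the two points
  -- differed, the divided difference of the minimal polynomial would vanish there, hence also on
  -- the diagonal, making the first value a multiple root.
  have heq : aeval (p 0) A / aeval (p 0) B = aeval (p 1) A / aeval (p 1) B := by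
    by_contra hne
    let h : MvPolynomial (Fin 2 × Fin 3) ℚ := ∑ i ∈ Finset.range (f.natDegree + 1),
      C (f.coeff i) * ∑ k ∈ Finset.range i, T 0 A ^ k * T 1 A ^ (i - 1 - k) *
        T 0 B ^ (f.natDegree - k) * T 1 B ^ (f.natDegree - (i - 1 - k))
    have hh : ∀ q : Fin 2 → Fin 3 → ℝ, aeval (q 0) B ≠ 0 → aeval (q 1) B ≠ 0 →
        aeval (fun c : Fin 2 × Fin 3 => q c.1 c.2) h = aeval (q 0) B ^ f.natDegree *
          aeval (q 1) B ^ f.natDegree * dividedDifference f (aeval (q 0) A / aeval (q 0) B)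
            (aeval (q 1) A / aeval (q 1) B) := by
      intro q h0 h1
      rw [← homogenized_dividedDifference f h0 h1]
      simp only [h, map_sum, map_mul, map_pow, hT, aeval_C, eq_ratCast]
    have hdd : dividedDifference f (aeval (p 0) A / aeval (p 0) B)
        (aeval (p 1) A / aeval (p 1) B) = 0 := by
      have := dividedDifference_mul_sub f (aeval (p 0) A / aeval (p 0) B)
        (aeval (p 1) A / aeval (p 1) B)
      rw [hfα, hfβ, sub_zero] at this
      exact (mul_eq_zero.1 this).resolve_right (sub_ne_zero.2 hne)
    have h1 := transfer h (by rw [hh p hB hB1, hdd, mul_zero]) (p 0) (hp.1 0) (p 0) (hp.1 0)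
    rw [hh ![p 0, p 0] hB hB] at h1
    have h2 := (mul_eq_zero.1 h1).resolve_left
      (mul_ne_zero (pow_ne_zero _ hB) (pow_ne_zero _ hB))
    have h3 := dividedDifference_self f (aeval (p 0) A / aeval (p 0) B)
    rw [show dividedDifference f (aeval (p 0) A / aeval (p 0) B)
      (aeval (p 0) A / aeval (p 0) B) = 0 from h2] at h3
    exact (minpoly.irreducible halg.isIntegral).separable.aeval_derivative_ne_zero hfα h3.symm
  rw [div_eq_div_iff hB hB1] at heq
  have h4 := transfer (T 0 A * T 1 B - T 1 A * T 0 B) (by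
    rw [map_sub, map_mul, map_mul, hT, hT, hT, hT, heq, sub_self]) x hx y hy
  rw [map_sub, map_mul, map_mul, hT, hT, hT, hT] at h4
  exact sub_eq_zero.1 h4

end Pairs

section TypeBound

variable {m : MvPolynomial (Fin 3) ℚ} {M : Set (Fin 3 → ℝ)}

theorem two_le_of_hasType {k : ℕ} (hk : HasType m M k)
    (h : ∀ n : ℕ, 2 ≤ n → ∀ p : Fin n → Fin 3 → ℝ, (∀ i, p i ∈ M) →
      2 ≤ finrank ℝ (flexSpace m (⊤ : SimpleGraph (Fin n)) p)) : 2 ≤ k :=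
  hk.2 fun n hn p hp => by
    rw [finrank_ker_rigidityMatrix]
    exact h n hn p hp

/-- The linear functional `a ↦ a ⬝ w`. -/
def dotFunctional (w : Fin 3 → ℝ) : (Fin 3 → ℝ) →ₗ[ℝ] ℝ where
  toFun a := a ⬝ᵥ w
  map_add' _ _ := add_dotProduct _ _ _
  map_smul' _ _ := smul_dotProduct _ _ _

theorem two_le_finrank_ker_dotFunctional (w : Fin 3 → ℝ) :
    2 ≤ finrank ℝ (LinearMap.ker (dotFunctional w)) := by
  have h1 := LinearMap.finrank_range_add_finrank_ker (dotFunctional w)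
  have h2 := Submodule.finrank_le (LinearMap.range (dotFunctional w))
  rw [finrank_fin_fun] at h1
  rw [finrank_self] at h2
  omega

/-- Translations orthogonal to `ν` are tangential everywhere. -/
theorem two_le_type_of_parallel {k : ℕ} (hk : HasType m M k) {ν : Fin 3 → ℝ}
    (h : ∀ x ∈ M, ∃ r : ℝ, normal m x = r • ν) : 2 ≤ k := by
  refine two_le_of_hasType hk fun n hn p hp => ?_
  refine (two_le_finrank_ker_dotFunctional ν).trans ?_
  have hmap : ∀ a ∈ LinearMap.ker (dotFunctional ν),
      motionMap p (0, a) ∈ flexSpace m (⊤ : SimpleGraph (Fin n)) p := by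
    intro a ha
    refine map_motionMap_le (M := M) hp ⟨(0, a), fun x hx => ?_, rfl⟩
    obtain ⟨r, hr⟩ := h x hx
    have ha' : a ⬝ᵥ ν = 0 := ha
    simp [hr, ha']
  refine LinearMap.finrank_le_finrank_of_injective
    (f := (motionMap p ∘ₗ LinearMap.inr ℝ _ _).restrict hmap) ?_
  intro a b hab
  have h0 : (motionMap p (0, (a : Fin 3 → ℝ))) ⟨0, by omega⟩ =
      (motionMap p (0, (b : Fin 3 → ℝ))) ⟨0, by omega⟩ :=
    congrFun (congrArg Subtype.val hab) _
  apply Subtype.ext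
  simpa [motionMap] using h0

/-- Rotations about `c` are tangential everywhere. Restricting to axes orthogonal to `p i₀ - c`
makes the velocity of the single point `p i₀` determine the rotation. -/
theorem two_le_type_of_concentric {k : ℕ} (hk : HasType m M k) {c : Fin 3 → ℝ}
    (hM : ∀ x ∈ M, normal m x ≠ 0)
    (h : ∀ x ∈ M, ∃ r : ℝ, normal m x = r • (x - c)) : 2 ≤ k := by
  refine two_le_of_hasType hk fun n hn p hp => ?_
  let i₀ : Fin n := ⟨0, by omega⟩
  refine (two_le_finrank_ker_dotFunctional (p i₀ - c)).trans ?_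
  let L : (Fin 3 → ℝ) →ₗ[ℝ] (Fin 3 → ℝ) × (Fin 3 → ℝ) :=
    LinearMap.prod LinearMap.id (-(crossProduct.flip c))
  have hL : ∀ a x, (L a).1 ⨯₃ x + (L a).2 = a ⨯₃ (x - c) := by
    intro a x
    simp [L, sub_eq_add_neg]
  have hmap : ∀ a ∈ LinearMap.ker (dotFunctional (p i₀ - c)),
      motionMap p (L a) ∈ flexSpace m (⊤ : SimpleGraph (Fin n)) p := by
    intro a _
    refine map_motionMap_le (M := M) hp ⟨L a, fun x hx => ?_, rfl⟩
    obtain ⟨r, hr⟩ := h x hx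
    rw [hL, hr, dotProduct_smul, dotProduct_comm, dot_cross_self, smul_zero]
  refine LinearMap.finrank_le_finrank_of_injective
    (f := (motionMap p ∘ₗ L).restrict hmap) ?_
  rw [← LinearMap.ker_eq_bot, LinearMap.ker_eq_bot']
  rintro ⟨a, ha⟩ h0
  have h1 : (L a).1 ⨯₃ p i₀ + (L a).2 = 0 := congrFun (congrArg Subtype.val h0) i₀
  rw [hL] at h1
  have ha' : a ⬝ᵥ (p i₀ - c) = 0 := ha
  have hw : p i₀ - c ≠ 0 := by
    intro hw
    obtain ⟨r, hr⟩ := h _ (hp i₀)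
    exact hM _ (hp i₀) (by rw [hr, hw, smul_zero])
  have h2 : (a ⬝ᵥ a) * ((p i₀ - c) ⬝ᵥ (p i₀ - c)) = 0 := by
    have := cross_dot_cross a (p i₀ - c) a (p i₀ - c)
    rw [h1, ha'] at this
    simpa using this.symm
  apply Subtype.ext
  rcases mul_eq_zero.1 h2 with h3 | h3
  · exact dotProduct_self_eq_zero.1 h3
  · exact absurd (dotProduct_self_eq_zero.1 h3) hw

end TypeBound

section NonUmbilic

variable {W : Type*} {m : MvPolynomial (Fin 3) ℚ} {M : Set (Fin 3 → ℝ)}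

/-- On an irreducible surface of type at most one, generic points are not umbilic. -/
theorem exists_not_umbilic (hM : IsIrreducibleSurface m M) {k : ℕ} (hk : HasType m M k)
    (hk1 : k ≤ 1) {p : W → Fin 3 → ℝ} (hp : IsGeneric m M p) {v w : W} (hvw : v ≠ w) :
    ∃ e, e ⬝ᵥ normal m (p v) = 0 ∧
      e ⬝ᵥ (hessian m (p v) *ᵥ (normal m (p v) ⨯₃ e)) ≠ 0 := by
  classical
  by_contra! humb
  have hlt : ¬ 2 ≤ k := by omega
  have hpv := hM.subset (hp.1 v)
  have hzero : ∀ x ∈ M, aeval x m = 0 := fun x hx => (hM.subset hx).1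
  have hpair : IsGeneric m M (p ∘ ![v, w]) :=
    hp.comp (r := fun u => if u = w then 1 else 0) (fun i => by
      fin_cases i
      · simp [hvw]
      · simp)
  obtain ⟨j, hj⟩ := Function.ne_iff.1 hpv.2
  obtain ⟨hflat, hcurved⟩ := isAlgebraic_of_umbilic hM.irreducible.ne_zero hpv.1
    (fun F hF => hp.dvd v hF) hj humb
  by_cases hP : aeval (p v) (curvatureNum m j) = 0
  · refine hlt (two_le_type_of_parallel hk (ν := fun i => normal m (p v) i / normal m (p v) j)
      fun x hx => ⟨normal m x j, ?_⟩)
    ext i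
    have := mul_eq_mul_of_isAlgebraic hzero hpair (A := pderiv i m) (B := pderiv j m) hj
      (hflat hP i) hx (hp.1 v)
    have h2 : normal m x i * normal m (p v) j = normal m (p v) i * normal m x j := this
    have hj' : normal m (p v) j ≠ 0 := hj
    rw [Pi.smul_apply, smul_eq_mul, mul_div_assoc', eq_div_iff hj']
    linarith
  · have hcurved' := hcurved hP
    refine hlt (two_le_type_of_concentric hk (fun x hx => (hM.subset hx).2)
      (c := fun i => p v i - normal m (p v) i * aeval (p v) (curvatureDen m j) /
        aeval (p v) (curvatureNum m j)) fun x hx =>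
        ⟨aeval x (curvatureNum m j) / aeval x (curvatureDen m j), ?_⟩)
    -- With a nonvanishing denominator the normal at every `x` in `M` is a multiple of `x - c`,
    -- without separate treatment of points where the numerator vanishes.
    have hS : aeval x (curvatureDen m j) ≠ 0 := by
      intro h0
      have hS' : aeval x (curvatureDen m j) = 2 * normal m x j ^ 2 + normal m x (j + 1) ^ 2
          + normal m x (j + 2) ^ 2 := by
        simp [curvatureDen, normal]
      rw [hS'] at h0
      have h1 : normal m x j = 0 := by
        by_contra h
        have := sq_pos_of_ne_zero h
        nlinarith [sq_nonneg (normal m x (j + 1)), sq_nonneg (normal m x (j + 2))]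
      have h2 : normal m x (j + 1) = 0 := by
        by_contra h
        have := sq_pos_of_ne_zero h
        nlinarith [sq_nonneg (normal m x j), sq_nonneg (normal m x (j + 2))]
      have h3 : normal m x (j + 2) = 0 := by
        by_contra h
        have := sq_pos_of_ne_zero h
        nlinarith [sq_nonneg (normal m x j), sq_nonneg (normal m x (j + 1))]
      apply (hM.subset hx).2
      rw [← dotProduct_self_eq_zero, dotProduct, sum_rotate j, h1, h2, h3]
      simp
    ext i
    have hdiv : aeval (p v) (X i * curvatureNum m j - pderiv i m * curvatureDen m j) /
        aeval (p v) (curvatureNum m j) = p v i - normal m (p v) i *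
          aeval (p v) (curvatureDen m j) / aeval (p v) (curvatureNum m j) := by
      rw [map_sub, map_mul, map_mul, aeval_X, sub_div, mul_div_cancel_right₀ _ hP]
      rfl
    have h1 := mul_eq_mul_of_isAlgebraic hzero hpair
      (A := X i * curvatureNum m j - pderiv i m * curvatureDen m j) (B := curvatureNum m j) hP
      (by
        have := hcurved' i
        rw [← hdiv] at this
        exact this) hx (hp.1 v)
    rw [div_eq_iff hP] at hdiv
    rw [hdiv, map_sub, map_mul, map_mul, aeval_X] at h1
    have h2 : (x i * aeval x (curvatureNum m j) - normal m x i * aeval x (curvatureDen m j)) =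
        (p v i - normal m (p v) i * aeval (p v) (curvatureDen m j) /
          aeval (p v) (curvatureNum m j)) * aeval x (curvatureNum m j) := by
      apply mul_right_cancel₀ hP
      refine h1.trans ?_
      ring
    rw [Pi.smul_apply, smul_eq_mul, Pi.sub_apply, div_mul_eq_mul_div, eq_div_iff hS]
    linear_combination -h2

end NonUmbilic

end SurfaceFramework

theorem corollary5p6 {V V' : Type*} [Fintype V] [Fintype V']
    (m : MvPolynomial (Fin 3) ℚ) (M : Set (Fin 3 → ℝ))
    (hM : SurfaceFramework.IsIrreducibleSurface m M)
    (k : ℕ) (hk : SurfaceFramework.HasType m M k) (hk' : k = 1 ∨ k = 0)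
    (G : SimpleGraph V) (G' : SimpleGraph V')
    (hmove : SurfaceFramework.IsVertexToK4Move G G') :
    (SurfaceFramework.GenericallyRigid m M G → SurfaceFramework.GenericallyRigid m M G') ∧
    (SurfaceFramework.GenericallyIndependent m M G →
      SurfaceFramework.GenericallyIndependent m M G') := by
  classical
  obtain ⟨v, f, ⟨φ⟩⟩ := hmove
  have hk1 : k ≤ 1 := by omega
  have hcomp : ∀ p : V' → Fin 3 → ℝ, SurfaceFramework.IsGeneric m M p →
      SurfaceFramework.IsGeneric m M (p ∘ φ.symm) := fun p hp =>
    hp.comp (r := φ) φ.apply_symm_apply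
  -- The new `K₄` supplies the second point of the generic pair, even when `G` has a single vertex.
  have h01 : (Sum.inr 0 : {x : V // x ≠ v} ⊕ Fin 4) ≠ Sum.inr 1 := by simp
  refine ⟨fun h p hp => ?_, fun h p hp => ?_⟩
  · exact SurfaceFramework.IsInfinitesimallyRigid.of_iso φ.symm
      (SurfaceFramework.isInfinitesimallyRigid_vertexToK4 hM h (hcomp p hp)
        (SurfaceFramework.exists_not_umbilic hM hk hk1 (hcomp p hp) h01))
  · exact SurfaceFramework.IsIndependent.of_iso φ.symm
      (SurfaceFramework.isIndependent_vertexToK4 hM h (hcomp p hp)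
        (SurfaceFramework.exists_not_umbilic hM hk hk1 (hcomp p hp) h01))
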